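/- Write $I=[0,1]$. For topological spaces $X,Y$ let $\mathbf{Top}(X,Y)$ be the following bicategory. * Its 0-cells are the continuous maps $f:X\to Y$, and its 1-cells $f\Rightarrow g$ are the homotopies $H:X\times I\to Y$ from $f$ to $g$. * Its 2-cells $H\Rrightarrow J$, for $H,J:f\Rightarrow g$, are the equivalence classes $[\alpha]$ of continuous maps $\alpha:X\times I\times I\to Y$ with $\alpha(-,-,0)=H$, $\alpha(-,-,1)=J$ and such that every $\alpha(-,-,t)$ is a homotopy from $f$ to $g$. Here $\alpha\sim\beta$ if there is a homotopy $\Gamma:X\times I\times I\times I\to Y$ from $\alpha$ to $\beta$ such that every $\Gamma(-,-,-,u)$ is again such a map from $H$ to $J$ (so that every $\Gamma(-,-,t,u)$ is a homotopy from $f$ to $g$). * 1-cells compose by concatenation, $(H_2\circ H_1)(x,s)=H_1(x,2s)$ for $s\le \frac12$ and $H_2(x,2s-1)$ for $s\ge\frac12$. 2-cells compose vertically by the same formula in the variable $t$, and horizontally by $(\beta*\alpha)(x,s,t)=\alpha(x,2s,t)$ for $s\le\frac12$ and $\beta(x,2s-1,t)$ for $s\ge\frac12$. Identities are constant homotopies,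 respectively their classes, and the associativity and unit constraints are the classes of the standard reparametrization homotopies. For spaces $X,Y,Z$ let $\otimes:\mathbf{Top}(Y,Z)\times\mathbf{Top}(X,Y)\to\mathbf{Top}(X,Z)$ be the strict functor with $$g\otimes f=gf,\qquad (J\otimes H)(x,s)=J(H(x,s),s),\qquad [\beta]\otimes[\alpha]=[\beta\otimes\alpha],\quad (\beta\otimes\alpha)(x,s,t)=\beta(\alpha(x,s,t),s,t).$$ Let $I_X:*\to\mathbf{Top}(X,X)$ be the strict functor from the terminal bicategory with value $1_X$ on the 0-cell, the constant homotopy on the 1-cell, and the class of the constant homotopy on the 2-cell. A tricategory consists of objects, hom-bicategories, composition functors $\otimes$ and unit functors $I$, adjoint equivalences $a:\otimes(\otimes\times 1)\to\otimes(1\times\otimes)$, $l:\otimes(I\times 1)\to 1$ and $r:\otimes(1\times I)\to 1$, and invertible modifications (with $r^{\bullet}$ the adjoint inverse of $r$) $$\pi:(1\otimes a)\,a\,(a\otimes 1)\cong a\,a,\quad \mu:(1\otimes l)\,a\,(r^{\bullet}\otimes 1)\cong 1,\quad \lambda:l\otimes 1\cong l\,a,\quad \rho:1\otimes r^{\bullet}\cong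 a\,r^{\bullet},$$ satisfying the non-abelian 4-cocycle condition and the left and right normalization conditions. **Theorem.** There is a tricategory $\mathbf{Top}$ whose objects are the topological spaces, whose hom-bicategories are the $\mathbf{Top}(X,Y)$, whose composition is given by the strict functors $\otimes$, and whose units are given by the strict functors $I_X$. In it the functors that $a$, $l$ and $r$ relate are equal, that is, $\otimes(\otimes\times1)=\otimes(1\times\otimes)$ and $\otimes(I\times1)=1=\otimes(1\times I)$, the adjoint equivalences $a,l,r$ are the identity adjoint equivalences, and all components of the invertible modifications $\pi,\mu,\lambda,\rho$ are identities. -/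

import Mathlib

open CategoryTheory Bicategory
open scoped Pseudofunctor.StrongTrans

universe u v w u₁ u₂ u₃ u₄ v₁ v₂ v₃ v₄ w₁ w₂ w₃ w₄

noncomputable section

namespace TopTricat

/-! ## Tricategories -/

/-! ### Auxiliary pseudofunctors -/

section Pseudofunctors

variable {A : Type u₁} [Bicategory.{w₁, v₁} A] {B : Type u₂} [Bicategory.{w₂, v₂} B]
  {C : Type u₃} [Bicategory.{w₃, v₃} C] {D : Type u₄} [Bicategory.{w₄, v₄} D]

/-- The product of two pseudofunctors. -/
def prodMap (F : A ⥤ᵖ B) (G : C ⥤ᵖ D) : (A × C) ⥤ᵖ (B × D) where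
  obj p := (F.obj p.1, G.obj p.2)
  map p := (F.map p.1, G.map p.2)
  map₂ η := (F.map₂ η.1, G.map₂ η.2)
  map₂_id _ := Prod.ext (F.map₂_id _) (G.map₂_id _)
  map₂_comp _ _ := Prod.ext (F.map₂_comp _ _) (G.map₂_comp _ _)
  mapId p := Iso.prod (F.mapId p.1) (G.mapId p.2)
  mapComp p q := Iso.prod (F.mapComp p.1 q.1) (G.mapComp p.2 q.2)
  map₂_whisker_left _ _ _ _ := Prod.ext (F.map₂_whisker_left _ _) (G.map₂_whisker_left _ _)
  map₂_whisker_right _ _ := Prod.ext (F.map₂_whisker_right _ _) (G.map₂_whisker_right _ _)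
  map₂_associator _ _ _ := Prod.ext (F.map₂_associator _ _ _) (G.map₂_associator _ _ _)
  map₂_left_unitor _ := Prod.ext (F.map₂_left_unitor _) (G.map₂_left_unitor _)
  map₂_right_unitor _ := Prod.ext (F.map₂_right_unitor _) (G.map₂_right_unitor _)

/-- The pseudofunctor into a product with two given components. -/
def pair (F : A ⥤ᵖ B) (G : A ⥤ᵖ C) : A ⥤ᵖ (B × C) where
  obj p := (F.obj p, G.obj p)
  map p := (F.map p, G.map p)
  map₂ η := (F.map₂ η, G.map₂ η)
  map₂_id _ := Prod.ext (F.map₂_id _) (G.map₂_id _)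
  map₂_comp _ _ := Prod.ext (F.map₂_comp _ _) (G.map₂_comp _ _)
  mapId p := Iso.prod (F.mapId p) (G.mapId p)
  mapComp p q := Iso.prod (F.mapComp p q) (G.mapComp p q)
  map₂_whisker_left _ _ _ _ := Prod.ext (F.map₂_whisker_left _ _) (G.map₂_whisker_left _ _)
  map₂_whisker_right _ _ := Prod.ext (F.map₂_whisker_right _ _) (G.map₂_whisker_right _ _)
  map₂_associator _ _ _ := Prod.ext (F.map₂_associator _ _ _) (G.map₂_associator _ _ _)
  map₂_left_unitor _ := Prod.ext (F.map₂_left_unitor _) (G.map₂_left_unitor _)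
  map₂_right_unitor _ := Prod.ext (F.map₂_right_unitor _) (G.map₂_right_unitor _)

theorem eq_id_comp_id {x y : A} {p q : x ⟶ y} (η : p ⟶ q) : η = 𝟙 p ≫ η ≫ 𝟙 q := by simp

theorem associator_eq {x y z t : A} (p : x ⟶ y) (q : y ⟶ z) (r : z ⟶ t) :
    (α_ p q r).hom = 𝟙 _ ≫ 𝟙 (p ≫ q) ▷ r ≫ (α_ p q r).hom ≫ p ◁ 𝟙 (q ≫ r) ≫ 𝟙 _ := by simp

theorem leftUnitor_eq {x y : A} (p : x ⟶ y) : (λ_ p).hom = 𝟙 _ ≫ 𝟙 (𝟙 x) ▷ p ≫ (λ_ p).hom := by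
  simp

theorem rightUnitor_eq {x y : A} (p : x ⟶ y) : (ρ_ p).hom = 𝟙 _ ≫ p ◁ 𝟙 (𝟙 y) ≫ (ρ_ p).hom := by
  simp

/-- The canonical isomorphism `(A × B) × C ≅ A × (B × C)`. -/
def prodAssoc (A : Type u₁) [Bicategory.{w₁, v₁} A] (B : Type u₂) [Bicategory.{w₂, v₂} B]
    (C : Type u₃) [Bicategory.{w₃, v₃} C] : ((A × B) × C) ⥤ᵖ (A × (B × C)) where
  obj p := (p.1.1, (p.1.2, p.2))
  map p := (p.1.1, (p.1.2, p.2))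
  map₂ η := (η.1.1, (η.1.2, η.2))
  mapId _ := Iso.refl _
  mapComp _ _ := Iso.refl _
  map₂_whisker_left _ _ _ _ :=
    Prod.ext (eq_id_comp_id _) (Prod.ext (eq_id_comp_id _) (eq_id_comp_id _))
  map₂_whisker_right _ _ :=
    Prod.ext (eq_id_comp_id _) (Prod.ext (eq_id_comp_id _) (eq_id_comp_id _))
  map₂_associator _ _ _ :=
    Prod.ext (associator_eq ..) (Prod.ext (associator_eq ..) (associator_eq ..))
  map₂_left_unitor _ :=
    Prod.ext (leftUnitor_eq _) (Prod.ext (leftUnitor_eq _) (leftUnitor_eq _))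
  map₂_right_unitor _ :=
    Prod.ext (rightUnitor_eq _) (Prod.ext (rightUnitor_eq _) (rightUnitor_eq _))

/-- The terminal bicategory. -/
abbrev Terminal : Type := LocallyDiscrete (Discrete PUnit.{1})

/-- The object of the terminal bicategory. -/
abbrev star : Terminal := ⟨⟨PUnit.unit⟩⟩

/-- The pseudofunctor to the terminal bicategory. -/
def toTerminal (A : Type u₁) [Bicategory.{w₁, v₁} A] : A ⥤ᵖ Terminal where
  obj _ := star
  map _ := 𝟙 star
  map₂ _ := 𝟙 _
  mapId _ := Iso.refl _
  mapComp _ _ := (λ_ (𝟙 star)).symm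

end Pseudofunctors

/-! ### Squares

For 1-cells in a bicategory, an isomorphism `p ≫ η' ≅ η ≫ q` is regarded as a square; the
naturality constraints of strong transformations are of this form. -/

section Squares

variable {A : Type u₁} [Bicategory.{w₁, v₁} A] {B : Type u₂} [Bicategory.{w₂, v₂} B]
  {C : Type u₃} [Bicategory.{w₃, v₃} C]

/-- The naturality square of an identity transformation. -/
def sqId {x y : B} (p : x ⟶ y) : p ≫ 𝟙 y ≅ 𝟙 x ≫ p := ρ_ p ≪≫ (λ_ p).symm

/-- The pasting of two naturality squares, that is, the naturality square of a composite of
transformations. -/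
def sqComp {x y x' y' x'' y'' : B} {p : x ⟶ y} {p' : x' ⟶ y'} {p'' : x'' ⟶ y''} {η : x ⟶ x'}
    {η' : y ⟶ y'} {θ : x' ⟶ x''} {θ' : y' ⟶ y''} (S : p ≫ η' ≅ η ≫ p') (T : p' ≫ θ' ≅ θ ≫ p'') :
    p ≫ η' ≫ θ' ≅ (η ≫ θ) ≫ p'' :=
  (α_ p η' θ').symm ≪≫ whiskerRightIso S θ' ≪≫ α_ η p' θ' ≪≫ whiskerLeftIso η T ≪≫
    (α_ η θ p'').symm

/-- The image of a pair of naturality squares under a pseudofunctor of two variables. -/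
def sqMap (F : (A × B) ⥤ᵖ C) {x y x' y' : A} {p : x ⟶ y} {p' : x' ⟶ y'} {η : x ⟶ x'}
    {η' : y ⟶ y'} {z t z' t' : B} {q : z ⟶ t} {q' : z' ⟶ t'} {θ : z ⟶ z'} {θ' : t ⟶ t'}
    (S : p ≫ η' ≅ η ≫ p') (T : q ≫ θ' ≅ θ ≫ q') :
    F.map (X := (x, z)) (Y := (y, t)) (p, q) ≫ F.map (X := (y, t)) (Y := (y', t')) (η', θ') ≅
      F.map (X := (x, z)) (Y := (x', z')) (η, θ) ≫
        F.map (X := (x', z')) (Y := (y', t')) (p', q') :=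
  (F.mapComp (a := (x, z)) (b := (y, t)) (c := (y', t')) (p, q) (η', θ')).symm ≪≫
    F.map₂Iso (Iso.prod S T) ≪≫
      F.mapComp (a := (x, z)) (b := (x', z')) (c := (y', t')) (η, θ) (p', q')

end Squares

section Tricategories

open Pseudofunctor.StrongTrans

/-- The identity adjoint equivalence between equal objects of a bicategory. -/
def equivalenceOfEq {B : Type u} [Bicategory.{w, v} B] {x y : B} (e : x = y) : x ≌ y :=
  e ▸ Bicategory.Equivalence.id x

/-! ### Tricategories -/

variable (O : Type u) (H : O → O → Type u₁) [∀ a b, Bicategory.{w, v} (H a b)]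

/-- The hom-bicategories being given, the composition and unit functors of a tricategory together
with its associativity and unit adjoint equivalences. -/
structure TricategoryData where
  /-- Composition `⊗ : H (b, c) × H (a, b) ⥤ H (a, c)`. -/
  comp (a b c : O) : (H b c × H a b) ⥤ᵖ H a c
  /-- The unit `1 ⥤ H (a, a)`. -/
  unit (a : O) : Terminal ⥤ᵖ H a a
  /-- The adjoint equivalence `⊗ ∘ (⊗ × 1) ≃ ⊗ ∘ (1 × ⊗)`. -/
  assoc (a b c d : O) :
    (prodMap (comp b c d) (.id (H a b))).comp (comp a b d) ≌
      (prodAssoc (H c d) (H b c) (H a b)).comp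
        ((prodMap (.id (H c d)) (comp a b c)).comp (comp a c d))
  /-- The adjoint equivalence `⊗ ∘ (I × 1) ≃ 1`. -/
  left (a b : O) :
    (pair ((toTerminal (H a b)).comp (unit b)) (.id (H a b))).comp (comp a b b) ≌ .id (H a b)
  /-- The adjoint equivalence `⊗ ∘ (1 × I) ≃ 1`. -/
  right (a b : O) :
    (pair (.id (H a b)) ((toTerminal (H a b)).comp (unit a))).comp (comp a a b) ≌ .id (H a b)

namespace TricategoryData

variable {O H} (T : TricategoryData O H) {a b c d e : O}

/-- Composition of 1-cells of the tricategory. -/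
def ten (g : H b c) (f : H a b) : H a c := (T.comp a b c).obj (g, f)

/-- Composition `⊗` of 2-cells of the tricategory. -/
def ten₁ {g g' : H b c} {f f' : H a b} (p : g ⟶ g') (q : f ⟶ f') : T.ten g f ⟶ T.ten g' f' :=
  (T.comp a b c).map (X := (g, f)) (Y := (g', f')) (p, q)

/-- Composition `⊗` of invertible 3-cells of the tricategory. -/
def ten₂ {g g' : H b c} {f f' : H a b} {p p' : g ⟶ g'} {q q' : f ⟶ f'} (η : p ≅ p')
    (θ : q ≅ q') : T.ten₁ p q ≅ T.ten₁ p' q' :=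
  (T.comp a b c).map₂Iso (a := (g, f)) (b := (g', f')) (f := (p, q)) (g := (p', q'))
    (Iso.prod η θ)

/-- Compatibility of `⊗` with identities. -/
def tenId (g : H b c) (f : H a b) : T.ten₁ (𝟙 g) (𝟙 f) ≅ 𝟙 (T.ten g f) :=
  (T.comp a b c).mapId (g, f)

/-- Compatibility of `⊗` with composition. -/
def tenComp {g g' g'' : H b c} {f f' f'' : H a b} (p : g ⟶ g') (p' : g' ⟶ g'') (q : f ⟶ f')
    (q' : f' ⟶ f'') : T.ten₁ (p ≫ p') (q ≫ q') ≅ T.ten₁ p q ≫ T.ten₁ p' q' :=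
  (T.comp a b c).mapComp (a := (g, f)) (b := (g', f')) (c := (g'', f'')) (p, q) (p', q')

/-- The composite `⊗` of two naturality squares. -/
def tenSq {x y x' y' : H b c} {p : x ⟶ y} {p' : x' ⟶ y'} {η : x ⟶ x'}
    {η' : y ⟶ y'} {z t z' t' : H a b} {q : z ⟶ t} {q' : z' ⟶ t'} {θ : z ⟶ z'} {θ' : t ⟶ t'}
    (S : p ≫ η' ≅ η ≫ p') (U : q ≫ θ' ≅ θ ≫ q') :
    T.ten₁ p q ≫ T.ten₁ η' θ' ≅ T.ten₁ η θ ≫ T.ten₁ p' q' :=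
  sqMap (T.comp a b c) S U

/-- The unit 1-cell `I_a`. -/
def I₀ (a : O) : H a a := (T.unit a).obj star

/-- The image of the identity 1-cell under the unit functor. -/
def I₁ (a : O) : T.I₀ a ⟶ T.I₀ a := (T.unit a).map (𝟙 star)

/-- The components of the associativity equivalence. -/
def asc (h : H c d) (g : H b c) (f : H a b) : T.ten (T.ten h g) f ⟶ T.ten h (T.ten g f) :=
  (T.assoc a b c d).hom.app ((h, g), f)

/-- The naturality constraints of the associativity equivalence. -/
def ascNat {h h' : H c d} {g g' : H b c} {f f' : H a b} (r : h ⟶ h') (q : g ⟶ g') (p : f ⟶ f') :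
    T.ten₁ (T.ten₁ r q) p ≫ T.asc h' g' f' ≅ T.asc h g f ≫ T.ten₁ r (T.ten₁ q p) :=
  (T.assoc a b c d).hom.naturality (a := ((h, g), f)) (b := ((h', g'), f')) ((r, q), p)

/-- The components `I ⊗ f ⟶ f` of the left unit equivalence. -/
def lft (f : H a b) : T.ten (T.I₀ b) f ⟶ f := (T.left a b).hom.app f

/-- The naturality constraints of the left unit equivalence. -/
def lftNat {f f' : H a b} (p : f ⟶ f') : T.ten₁ (T.I₁ b) p ≫ T.lft f' ≅ T.lft f ≫ p :=
  (T.left a b).hom.naturality p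

/-- The components `f ⟶ f ⊗ I` of the chosen adjoint inverse of the right unit equivalence. -/
def rgt (f : H a b) : f ⟶ T.ten f (T.I₀ a) := (T.right a b).inv.app f

/-- The naturality constraints of the chosen adjoint inverse of the right unit equivalence. -/
def rgtNat {f f' : H a b} (p : f ⟶ f') : p ≫ T.rgt f' ≅ T.rgt f ≫ T.ten₁ p (T.I₁ a) :=
  (T.right a b).inv.naturality p

/-! #### Composition with an identity 2-cell -/

/-- The 2-cell `p ⊗ 1_f`. -/
def whR {g g' : H b c} (p : g ⟶ g') (f : H a b) : T.ten g f ⟶ T.ten g' f := T.ten₁ p (𝟙 f)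

/-- The 2-cell `1_g ⊗ p`. -/
def whL (g : H b c) {f f' : H a b} (p : f ⟶ f') : T.ten g f ⟶ T.ten g f' := T.ten₁ (𝟙 g) p

/-- The 3-cell `η ⊗ 1_f`. -/
def whR₂ {g g' : H b c} {p p' : g ⟶ g'} (η : p ≅ p') (f : H a b) : T.whR p f ≅ T.whR p' f :=
  T.ten₂ η (.refl _)

/-- The 3-cell `1_g ⊗ η`. -/
def whL₂ (g : H b c) {f f' : H a b} {p p' : f ⟶ f'} (η : p ≅ p') : T.whL g p ≅ T.whL g p' :=
  T.ten₂ (.refl _) η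

/-- `(p ≫ q) ⊗ 1_f ≅ (p ⊗ 1_f) ≫ (q ⊗ 1_f)`. -/
def whRComp {g g' g'' : H b c} (p : g ⟶ g') (q : g' ⟶ g'') (f : H a b) :
    T.whR (p ≫ q) f ≅ T.whR p f ≫ T.whR q f :=
  T.ten₂ (.refl _) (λ_ (𝟙 f)).symm ≪≫ T.tenComp p q (𝟙 f) (𝟙 f)

/-- `1_g ⊗ (p ≫ q) ≅ (1_g ⊗ p) ≫ (1_g ⊗ q)`. -/
def whLComp (g : H b c) {f f' f'' : H a b} (p : f ⟶ f') (q : f' ⟶ f'') :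
    T.whL g (p ≫ q) ≅ T.whL g p ≫ T.whL g q :=
  T.ten₂ (λ_ (𝟙 g)).symm (.refl _) ≪≫ T.tenComp (𝟙 g) (𝟙 g) p q

/-- `(p ≫ q ≫ r) ⊗ 1_f ≅ (p ⊗ 1_f) ≫ (q ⊗ 1_f) ≫ (r ⊗ 1_f)`. -/
def whRComp₃ {g g' g'' g₃ : H b c} (p : g ⟶ g') (q : g' ⟶ g'') (r : g'' ⟶ g₃) (f : H a b) :
    T.whR (p ≫ q ≫ r) f ≅ T.whR p f ≫ T.whR q f ≫ T.whR r f :=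
  T.whRComp p (q ≫ r) f ≪≫ whiskerLeftIso _ (T.whRComp q r f)

/-- `1_g ⊗ (p ≫ q ≫ r) ≅ (1_g ⊗ p) ≫ (1_g ⊗ q) ≫ (1_g ⊗ r)`. -/
def whLComp₃ (g : H b c) {f f' f'' f₃ : H a b} (p : f ⟶ f') (q : f' ⟶ f'') (r : f'' ⟶ f₃) :
    T.whL g (p ≫ q ≫ r) ≅ T.whL g p ≫ T.whL g q ≫ T.whL g r :=
  T.whLComp g p (q ≫ r) ≪≫ whiskerLeftIso _ (T.whLComp g q r)

/-- Naturality of the associativity equivalence in its first variable. -/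
def ascNat₁ {h h' : H c d} (p : h ⟶ h') (g : H b c) (f : H a b) :
    T.whR (T.whR p g) f ≫ T.asc h' g f ≅ T.asc h g f ≫ T.whR p (T.ten g f) :=
  T.ascNat p (𝟙 g) (𝟙 f) ≪≫ whiskerLeftIso _ (T.ten₂ (.refl _) (T.tenId g f))

/-- Naturality of the associativity equivalence in its second variable. -/
def ascNat₂ (h : H c d) {g g' : H b c} (p : g ⟶ g') (f : H a b) :
    T.whR (T.whL h p) f ≫ T.asc h g' f ≅ T.asc h g f ≫ T.whL h (T.whR p f) :=
  T.ascNat (𝟙 h) p (𝟙 f)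

/-- Naturality of the associativity equivalence in its third variable. -/
def ascNat₃ (h : H c d) (g : H b c) {f f' : H a b} (p : f ⟶ f') :
    T.whL (T.ten h g) p ≫ T.asc h g f' ≅ T.asc h g f ≫ T.whL h (T.whL g p) :=
  whiskerRightIso (T.ten₂ (T.tenId h g).symm (.refl _)) _ ≪≫ T.ascNat (𝟙 h) (𝟙 g) p

end TricategoryData

/-- Four families of invertible modifications `π`, `μ`, `lam`, `rho` as in the definition of a
tricategory. In each naturality condition, the two composites of squares are the naturality
constraints of the two transformations between which the modification goes. -/
structure TricategoryModifications (T : TricategoryData O H) where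
  /-- The modification `(1 ⊗ a) a (a ⊗ 1) ≅ a a`. -/
  π {a b c d e : O} (k : H d e) (h : H c d) (g : H b c) (f : H a b) :
    T.whR (T.asc k h g) f ≫
        T.asc k (T.ten h g) f ≫
          T.whL k (T.asc h g f) ≅
      T.asc (T.ten k h) g f ≫
        T.asc k h (T.ten g f)
  /-- The modification `(1 ⊗ l) a (s ⊗ 1) ≅ 1`, where `s` is the adjoint inverse of `r`. -/
  μ {a b c : O} (g : H b c) (f : H a b) :
    T.whR (T.rgt g) f ≫
        T.asc g (T.I₀ b) f ≫
          T.whL g (T.lft f) ≅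
      𝟙 (T.ten g f)
  /-- The modification `l ⊗ 1 ≅ l a`. -/
  lam {a b c : O} (g : H b c) (f : H a b) :
    T.whR (T.lft g) f ≅
      T.asc (T.I₀ c) g f ≫
        T.lft (T.ten g f)
  /-- The modification `1 ⊗ s ≅ a s`, where `s` is the adjoint inverse of `r`. -/
  rho {a b c : O} (g : H b c) (f : H a b) :
    T.whL g (T.rgt f) ≅
      T.rgt (T.ten g f) ≫
        T.asc g f (T.I₀ a)
  π_naturality {a b c d e : O} {k k' : H d e} {h h' : H c d} {g g' : H b c} {f f' : H a b}
    (s : k ⟶ k') (r : h ⟶ h') (q : g ⟶ g') (p : f ⟶ f') :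
    (sqComp (T.tenSq (T.ascNat s r q) (sqId p))
        (sqComp (T.ascNat s (T.ten₁ r q) p)
          (T.tenSq (sqId s) (T.ascNat r q p)))).hom ≫
        (π k h g f).hom ▷ _ =
      _ ◁ (π k' h' g' f').hom ≫
        (sqComp (T.ascNat (T.ten₁ s r) q p)
          (T.ascNat s r (T.ten₁ q p))).hom
  μ_naturality {a b c : O} {g g' : H b c} {f f' : H a b} (q : g ⟶ g') (p : f ⟶ f') :
    (sqComp (T.tenSq (T.rgtNat q) (sqId p))
        (sqComp (T.ascNat q (T.I₁ b) p)
          (T.tenSq (sqId q) (T.lftNat p)))).hom ≫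
        (μ g f).hom ▷ _ =
      _ ◁ (μ g' f').hom ≫ (sqId (T.ten₁ q p)).hom
  lam_naturality {a b c : O} {g g' : H b c} {f f' : H a b} (q : g ⟶ g') (p : f ⟶ f') :
    (T.tenSq (T.lftNat q) (sqId p)).hom ≫ (lam g f).hom ▷ _ =
      _ ◁ (lam g' f').hom ≫
        (sqComp (T.ascNat (T.I₁ c) q p)
          (T.lftNat (T.ten₁ q p))).hom
  rho_naturality {a b c : O} {g g' : H b c} {f f' : H a b} (q : g ⟶ g') (p : f ⟶ f') :
    (T.tenSq (sqId q) (T.rgtNat p)).hom ≫ (rho g f).hom ▷ _ =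
      _ ◁ (rho g' f').hom ≫
        (sqComp (T.rgtNat (T.ten₁ q p))
          (T.ascNat q p (T.I₁ a))).hom

namespace TricategoryModifications

variable {O H} {T : TricategoryData O H} (M : TricategoryModifications O H T) {a b c d e e' : O}

/-- `π ⊗ 1_f`. -/
def πR (k : H e e') (j : H d e) (h : H c d) (g : H b c) (f : H a b) :
    T.whR (T.whR (T.asc k j h) g) f ≫ T.whR (T.asc k (T.ten j h) g) f ≫
        T.whR (T.whL k (T.asc j h g)) f ≅
      T.whR (T.asc (T.ten k j) h g) f ≫ T.whR (T.asc k j (T.ten h g)) f :=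
  (T.whRComp₃ _ _ _ f).symm ≪≫ T.whR₂ (M.π k j h g) f ≪≫ T.whRComp _ _ f

/-- `1_k ⊗ π`. -/
def πL (k : H e e') (j : H d e) (h : H c d) (g : H b c) (f : H a b) :
    T.whL k (T.whR (T.asc j h g) f) ≫ T.whL k (T.asc j (T.ten h g) f) ≫
        T.whL k (T.whL j (T.asc h g f)) ≅
      T.whL k (T.asc (T.ten j h) g f) ≫ T.whL k (T.asc j h (T.ten g f)) :=
  (T.whLComp₃ k _ _ _).symm ≪≫ T.whL₂ k (M.π j h g f) ≪≫ T.whLComp k _ _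

/-- `μ ⊗ 1_f`. -/
def μR (h : H c d) (g : H b c) (f : H a b) :
    T.whR (T.whR (T.rgt h) g) f ≫ T.whR (T.asc h (T.I₀ c) g) f ≫ T.whR (T.whL h (T.lft g)) f ≅
      𝟙 (T.ten (T.ten h g) f) :=
  (T.whRComp₃ _ _ _ f).symm ≪≫ T.whR₂ (M.μ h g) f ≪≫ T.tenId _ f

/-- `1_h ⊗ μ`. -/
def μL (h : H c d) (g : H b c) (f : H a b) :
    T.whL h (T.whR (T.rgt g) f) ≫ T.whL h (T.asc g (T.I₀ b) f) ≫ T.whL h (T.whL g (T.lft f)) ≅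
      𝟙 (T.ten h (T.ten g f)) :=
  (T.whLComp₃ h _ _ _).symm ≪≫ T.whL₂ h (M.μ g f) ≪≫ T.tenId h _

/-- `1_h ⊗ lam`. -/
def lamL (h : H c d) (g : H b c) (f : H a b) :
    T.whL h (T.whR (T.lft g) f) ≅
      T.whL h (T.asc (T.I₀ c) g f) ≫ T.whL h (T.lft (T.ten g f)) :=
  T.whL₂ h (M.lam g f) ≪≫ T.whLComp h _ _

/-- `rho ⊗ 1_f`. -/
def rhoR (h : H c d) (g : H b c) (f : H a b) :
    T.whR (T.whL h (T.rgt g)) f ≅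
      T.whR (T.rgt (T.ten h g)) f ≫ T.whR (T.asc h g (T.I₀ b)) f :=
  T.whR₂ (M.rho h g) f ≪≫ T.whRComp _ _ f

/-- The non-abelian 4-cocycle condition: the two ways of pasting instances of `π` and naturality
constraints of `a` between the boundary paths from `(((k ⊗ j) ⊗ h) ⊗ g) ⊗ f` to
`k ⊗ (j ⊗ (h ⊗ (g ⊗ f)))` of the associahedron agree. -/
def Cocycle (k : H e e') (j : H d e) (h : H c d) (g : H b c) (f : H a b) : Prop :=
  (𝟙 (T.whR (T.whR (T.asc k j h) g) f ≫ T.whR (T.asc k (T.ten j h) g) f ≫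
      T.whR (T.whL k (T.asc j h g)) f ≫ T.asc k (T.ten j (T.ten h g)) f ≫
        T.whL k (T.asc j (T.ten h g) f) ≫ T.whL k (T.whL j (T.asc h g f))) ⊗≫
    (M.πR k j h g f).hom ▷ (T.asc k (T.ten j (T.ten h g)) f ≫
      T.whL k (T.asc j (T.ten h g) f) ≫ T.whL k (T.whL j (T.asc h g f))) ⊗≫
    T.whR (T.asc (T.ten k j) h g) f ◁ (M.π k j (T.ten h g) f).hom ▷
      T.whL k (T.whL j (T.asc h g f)) ⊗≫
    (T.whR (T.asc (T.ten k j) h g) f ≫ T.asc (T.ten k j) (T.ten h g) f) ◁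
      (T.ascNat₃ k j (T.asc h g f)).inv ⊗≫
    (M.π (T.ten k j) h g f).hom ▷ T.asc k j (T.ten h (T.ten g f)) ⊗≫
    𝟙 (T.asc (T.ten (T.ten k j) h) g f ≫ T.asc (T.ten k j) h (T.ten g f) ≫
      T.asc k j (T.ten h (T.ten g f)))) =
  (𝟙 _ ⊗≫
    (T.whR (T.whR (T.asc k j h) g) f ≫ T.whR (T.asc k (T.ten j h) g) f) ◁
      (T.ascNat₂ k (T.asc j h g) f).hom ▷
        (T.whL k (T.asc j (T.ten h g) f) ≫ T.whL k (T.whL j (T.asc h g f))) ⊗≫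
    (T.whR (T.whR (T.asc k j h) g) f ≫ T.whR (T.asc k (T.ten j h) g) f ≫
      T.asc k (T.ten (T.ten j h) g) f) ◁ (M.πL k j h g f).hom ⊗≫
    T.whR (T.whR (T.asc k j h) g) f ◁ (M.π k (T.ten j h) g f).hom ▷
      T.whL k (T.asc j h (T.ten g f)) ⊗≫
    (T.ascNat₁ (T.asc k j h) g f).hom ▷
      (T.asc k (T.ten j h) (T.ten g f) ≫ T.whL k (T.asc j h (T.ten g f))) ⊗≫
    T.asc (T.ten (T.ten k j) h) g f ◁ (M.π k j h (T.ten g f)).hom ⊗≫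
    𝟙 _)

/-- The left normalization condition. -/
def LeftNormalization (h : H c d) (g : H b c) (f : H a b) : Prop :=
  (𝟙 (T.whR (T.whR (T.rgt h) g) f ≫ T.whR (T.asc h (T.I₀ c) g) f ≫
      T.asc h (T.ten (T.I₀ c) g) f ≫ T.whL h (T.whR (T.lft g) f)) ⊗≫
    (T.whR (T.whR (T.rgt h) g) f ≫ T.whR (T.asc h (T.I₀ c) g) f ≫
      T.asc h (T.ten (T.I₀ c) g) f) ◁ (M.lamL h g f).hom ⊗≫
    T.whR (T.whR (T.rgt h) g) f ◁ (M.π h (T.I₀ c) g f).hom ▷ T.whL h (T.lft (T.ten g f)) ⊗≫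
    (T.ascNat₁ (T.rgt h) g f).hom ▷
      (T.asc h (T.I₀ c) (T.ten g f) ≫ T.whL h (T.lft (T.ten g f))) ⊗≫
    T.asc h g f ◁ (M.μ h (T.ten g f)).hom ⊗≫
    𝟙 (T.asc h g f)) =
  (𝟙 _ ⊗≫
    (T.whR (T.whR (T.rgt h) g) f ≫ T.whR (T.asc h (T.I₀ c) g) f) ◁
      (T.ascNat₂ h (T.lft g) f).inv ⊗≫
    (M.μR h g f).hom ▷ T.asc h g f ⊗≫
    𝟙 _)

/-- The right normalization condition. -/
def RightNormalization (h : H c d) (g : H b c) (f : H a b) : Prop :=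
  (𝟙 (T.whR (T.whL h (T.rgt g)) f ≫ T.asc h (T.ten g (T.I₀ b)) f ≫
      T.whL h (T.asc g (T.I₀ b) f) ≫ T.whL h (T.whL g (T.lft f))) ⊗≫
    (M.rhoR h g f).hom ▷ (T.asc h (T.ten g (T.I₀ b)) f ≫
      T.whL h (T.asc g (T.I₀ b) f) ≫ T.whL h (T.whL g (T.lft f))) ⊗≫
    T.whR (T.rgt (T.ten h g)) f ◁ (M.π h g (T.I₀ b) f).hom ▷ T.whL h (T.whL g (T.lft f)) ⊗≫
    (T.whR (T.rgt (T.ten h g)) f ≫ T.asc (T.ten h g) (T.I₀ b) f) ◁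
      (T.ascNat₃ h g (T.lft f)).inv ⊗≫
    (M.μ (T.ten h g) f).hom ▷ T.asc h g f ⊗≫
    𝟙 (T.asc h g f)) =
  (𝟙 _ ⊗≫
    (T.ascNat₂ h (T.rgt g) f).hom ▷
      (T.whL h (T.asc g (T.I₀ b) f) ≫ T.whL h (T.whL g (T.lft f))) ⊗≫
    T.asc h g f ◁ (M.μL h g f).hom ⊗≫
    𝟙 _)

end TricategoryModifications

/-- A tricategory with objects `O` and hom-bicategories `H a b`: composition and unit functors,
adjoint equivalences for associativity and units, and four families of invertible modifications,
subject to the non-abelian 4-cocycle condition and the two normalization conditions. -/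
structure Tricategory extends TricategoryData O H where
  mods : TricategoryModifications O H toTricategoryData
  cocycle {a b c d e e' : O} (k : H e e') (j : H d e) (h : H c d) (g : H b c) (f : H a b) :
    mods.Cocycle k j h g f
  left_normalization {a b c d : O} (h : H c d) (g : H b c) (f : H a b) :
    mods.LeftNormalization h g f
  right_normalization {a b c d : O} (h : H c d) (g : H b c) (f : H a b) :
    mods.RightNormalization h g f

end Tricategories

/-! ## Homotopies and homotopies between homotopies -/

section Homotopies

open scoped unitInterval

variable {X : Type u} {Y : Type v} [TopologicalSpace X] [TopologicalSpace Y]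

/-- A homotopy `α : I × I × X → Y` between the homotopies `H, J : f ⇒ g`, evaluated at
`(t, (s, x))`: at each time `t` the map `α (t, ·)` is itself a homotopy `f ⇒ g`. -/
structure TwoHomotopy {f g : C(X, Y)} (H J : f.Homotopy g) extends
    ContinuousMap.Homotopy H.toContinuousMap J.toContinuousMap where
  left : ∀ t x, toFun (t, (0, x)) = f x
  right : ∀ t x, toFun (t, (1, x)) = g x

/-- The boundary of `I × I`, times `X`. -/
def squareBoundary (X : Type u) : Set (I × (I × X)) :=
  {q | q.1 = 0 ∨ q.1 = 1 ∨ q.2.1 = 0 ∨ q.2.1 = 1}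

namespace TwoHomotopy

variable {f g h k : C(X, Y)} {H J K L : f.Homotopy g}

instance : FunLike (TwoHomotopy H J) (I × (I × X)) Y where
  coe α := α.toFun
  coe_injective α β e := by
    obtain ⟨α, _, _⟩ := α
    obtain ⟨β, _, _⟩ := β
    have : α = β := ContinuousMap.Homotopy.ext (fun x => congrFun e x)
    subst this
    rfl

@[ext]
theorem ext {α β : TwoHomotopy H J} (e : ∀ t s x, α (t, (s, x)) = β (t, (s, x))) : α = β :=
  DFunLike.ext _ _ (fun ⟨t, s, x⟩ => e t s x)

theorem continuous (α : TwoHomotopy H J) : Continuous α := α.continuous_toFun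

@[simp] theorem apply_zero (α : TwoHomotopy H J) (q : I × X) : α (0, q) = H q := α.map_zero_left q
@[simp] theorem apply_one (α : TwoHomotopy H J) (q : I × X) : α (1, q) = J q := α.map_one_left q
@[simp] theorem apply_left (α : TwoHomotopy H J) (t : I) (x : X) : α (t, (0, x)) = f x :=
  α.left t x
@[simp] theorem apply_right (α : TwoHomotopy H J) (t : I) (x : X) : α (t, (1, x)) = g x :=
  α.right t x

/-- Two homotopies `α, β : H ⇛ J` are equivalent if there is a homotopy `Γ` from `α` to `β` such
that, at each time `u`, the map `Γ (u, ·)` is a homotopy `H ⇛ J` between homotopies `f ⇒ g`;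
that is, `Γ` is a homotopy relative to the boundary of the square. -/
def Equivalent (α β : TwoHomotopy H J) : Prop :=
  ContinuousMap.HomotopicRel α.toContinuousMap β.toContinuousMap (squareBoundary X)

instance setoid (H J : f.Homotopy g) : Setoid (TwoHomotopy H J) where
  r := Equivalent
  iseqv := ⟨fun _ => .refl _, fun e => e.symm, fun e e' => e.trans e'⟩

/-- The identity homotopy of `H`. -/
def refl (H : f.Homotopy g) : TwoHomotopy H H where
  toHomotopy := .refl _
  left _ x := H.map_zero_left x
  right _ x := H.map_one_left x

@[simp] theorem refl_apply (H : f.Homotopy g) (q : I × (I × X)) : refl H q = H q.2 := rfl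

/-- Projection of the reals onto the unit interval. -/
abbrev pr (a : ℝ) : I := Set.projIcc 0 1 zero_le_one a

theorem htrans_apply (F : f.Homotopy g) (G : g.Homotopy h) (s : I) (x : X) :
    F.trans G (s, x) = if (s : ℝ) ≤ 1 / 2 then F (pr (2 * s), x) else G (pr (2 * s - 1), x) :=
  rfl

/-- Vertical composition: first `α`, on `0 ≤ t ≤ 1/2`, then `β`. -/
def vcomp (α : TwoHomotopy H J) (β : TwoHomotopy J K) : TwoHomotopy H K where
  toHomotopy := α.toHomotopy.trans β.toHomotopy
  left t x := by
    change (α.toHomotopy.trans β.toHomotopy) (t, (0, x)) = _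
    rw [htrans_apply]
    split_ifs
    · exact α.left _ x
    · exact β.left _ x
  right t x := by
    change (α.toHomotopy.trans β.toHomotopy) (t, (1, x)) = _
    rw [htrans_apply]
    split_ifs
    · exact α.right _ x
    · exact β.right _ x

theorem vcomp_apply (α : TwoHomotopy H J) (β : TwoHomotopy J K) (t s : I) (x : X) :
    α.vcomp β (t, (s, x)) =
      if (t : ℝ) ≤ 1 / 2 then α (pr (2 * t), (s, x)) else β (pr (2 * t - 1), (s, x)) :=
  rfl

/-- Exchange of the two parameters of a homotopy of homotopies. -/
def flip (α : TwoHomotopy H J) :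
    (f.comp (ContinuousMap.snd : C(I × X, X))).Homotopy (g.comp ContinuousMap.snd) where
  toFun q := α (q.2.1, (q.1, q.2.2))
  continuous_toFun := α.continuous.comp (by fun_prop)
  map_zero_left q := α.left _ _
  map_one_left q := α.right _ _

/-- Horizontal composition: first `α`, on `0 ≤ s ≤ 1/2`, then `β`. -/
def hcomp {H H' : f.Homotopy g} {J J' : g.Homotopy h} (α : TwoHomotopy H H')
    (β : TwoHomotopy J J') : TwoHomotopy (H.trans J) (H'.trans J') where
  toFun q := α.flip.trans β.flip (q.2.1, (q.1, q.2.2))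
  continuous_toFun := (α.flip.trans β.flip).continuous.comp (by fun_prop)
  map_zero_left q := by
    obtain ⟨s, x⟩ := q
    change _ = H.trans J (s, x)
    rw [htrans_apply, htrans_apply]
    split_ifs
    · exact α.apply_zero _
    · exact β.apply_zero _
  map_one_left q := by
    obtain ⟨s, x⟩ := q
    change _ = H'.trans J' (s, x)
    rw [htrans_apply, htrans_apply]
    split_ifs
    · exact α.apply_one _
    · exact β.apply_one _
  left t x := (α.flip.trans β.flip).map_zero_left (t, x)
  right t x := (α.flip.trans β.flip).map_one_left (t, x)

theorem hcomp_apply {H H' : f.Homotopy g} {J J' : g.Homotopy h} (α : TwoHomotopy H H')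
    (β : TwoHomotopy J J') (t s : I) (x : X) :
    α.hcomp β (t, (s, x)) =
      if (s : ℝ) ≤ 1 / 2 then α (t, (pr (2 * s), x)) else β (t, (pr (2 * s - 1), x)) :=
  rfl

/-! ### Compatibility with the equivalence relation -/

theorem Equivalent.vcomp {α α' : TwoHomotopy H J} {β β' : TwoHomotopy J K}
    (hα : Equivalent α α') (hβ : Equivalent β β') : Equivalent (α.vcomp β) (α'.vcomp β') := by
  obtain ⟨A⟩ := hα
  obtain ⟨B⟩ := hβ
  have hA : ∀ u q, q ∈ squareBoundary X → A (u, q) = α q := fun u q hq => A.eq_fst u hq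
  have hB : ∀ u q, q ∈ squareBoundary X → B (u, q) = β q := fun u q hq => B.eq_fst u hq
  have A0 : ∀ q, A (0, q) = α q := A.apply_zero
  have A1 : ∀ q, A (1, q) = α' q := A.apply_one
  have B0 : ∀ q, B (0, q) = β q := B.apply_zero
  have B1 : ∀ q, B (1, q) = β' q := B.apply_one
  let e : C(I × (I × X), I × X) := ⟨fun q => q.2, by fun_prop⟩
  let A' : (H.toContinuousMap.comp e).Homotopy (J.toContinuousMap.comp e) :=
    { toFun := fun q => A (q.2.1, (q.1, q.2.2))
      continuous_toFun := A.continuous.comp (by fun_prop)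
      map_zero_left := fun q => (hA _ _ (Or.inl rfl)).trans (α.apply_zero _)
      map_one_left := fun q => (hA _ _ (Or.inr (Or.inl rfl))).trans (α.apply_one _) }
  let B' : (J.toContinuousMap.comp e).Homotopy (K.toContinuousMap.comp e) :=
    { toFun := fun q => B (q.2.1, (q.1, q.2.2))
      continuous_toFun := B.continuous.comp (by fun_prop)
      map_zero_left := fun q => (hB _ _ (Or.inl rfl)).trans (β.apply_zero _)
      map_one_left := fun q => (hB _ _ (Or.inr (Or.inl rfl))).trans (β.apply_one _) }
  have key : ∀ (u t s : I) (x : X), A'.trans B' (t, (u, (s, x))) =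
      if (t : ℝ) ≤ 1 / 2 then A (u, (pr (2 * t), (s, x))) else B (u, (pr (2 * t - 1), (s, x))) :=
    fun _ _ _ _ => rfl
  refine ⟨⟨⟨⟨fun q => A'.trans B' (q.2.1, (q.1, q.2.2)),
    (A'.trans B').continuous.comp (by fun_prop)⟩, ?_, ?_⟩, ?_⟩⟩
  · rintro ⟨t, s, x⟩
    change A'.trans B' (t, (0, (s, x))) = α.vcomp β (t, (s, x))
    rw [key, vcomp_apply, A0, B0]
  · rintro ⟨t, s, x⟩
    change A'.trans B' (t, (1, (s, x))) = α'.vcomp β' (t, (s, x))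
    rw [key, vcomp_apply, A1, B1]
  · rintro u ⟨t, s, x⟩ (ht | ht | hs | hs)
    · obtain rfl : t = 0 := ht
      change A'.trans B' (0, (u, (s, x))) = α.vcomp β (0, (s, x))
      rw [(A'.trans B').apply_zero, apply_zero]; rfl
    · obtain rfl : t = 1 := ht
      change A'.trans B' (1, (u, (s, x))) = α.vcomp β (1, (s, x))
      rw [(A'.trans B').apply_one, apply_one]; rfl
    · obtain rfl : s = 0 := hs
      change A'.trans B' (t, (u, (0, x))) = α.vcomp β (t, (0, x))
      rw [key, vcomp_apply, hA _ _ (Or.inr (Or.inr (Or.inl rfl))),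
        hB _ _ (Or.inr (Or.inr (Or.inl rfl)))]
    · obtain rfl : s = 1 := hs
      change A'.trans B' (t, (u, (1, x))) = α.vcomp β (t, (1, x))
      rw [key, vcomp_apply, hA _ _ (Or.inr (Or.inr (Or.inr rfl))),
        hB _ _ (Or.inr (Or.inr (Or.inr rfl)))]

theorem Equivalent.hcomp {H H' : f.Homotopy g} {J J' : g.Homotopy h} {α α' : TwoHomotopy H H'}
    {β β' : TwoHomotopy J J'} (hα : Equivalent α α') (hβ : Equivalent β β') :
    Equivalent (α.hcomp β) (α'.hcomp β') := by
  obtain ⟨A⟩ := hα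
  obtain ⟨B⟩ := hβ
  have hA : ∀ u q, q ∈ squareBoundary X → A (u, q) = α q := fun u q hq => A.eq_fst u hq
  have hB : ∀ u q, q ∈ squareBoundary X → B (u, q) = β q := fun u q hq => B.eq_fst u hq
  have A0 : ∀ q, A (0, q) = α q := A.apply_zero
  have A1 : ∀ q, A (1, q) = α' q := A.apply_one
  have B0 : ∀ q, B (0, q) = β q := B.apply_zero
  have B1 : ∀ q, B (1, q) = β' q := B.apply_one
  let e : C(I × (I × X), X) := ⟨fun q => q.2.2, by fun_prop⟩
  let A' : (f.comp e).Homotopy (g.comp e) :=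
    { toFun := fun q => A (q.2.1, (q.2.2.1, (q.1, q.2.2.2)))
      continuous_toFun := A.continuous.comp (by fun_prop)
      map_zero_left := fun q => (hA _ _ (Or.inr (Or.inr (Or.inl rfl)))).trans (α.apply_left _ _)
      map_one_left := fun q => (hA _ _ (Or.inr (Or.inr (Or.inr rfl)))).trans (α.apply_right _ _) }
  let B' : (g.comp e).Homotopy (h.comp e) :=
    { toFun := fun q => B (q.2.1, (q.2.2.1, (q.1, q.2.2.2)))
      continuous_toFun := B.continuous.comp (by fun_prop)
      map_zero_left := fun q => (hB _ _ (Or.inr (Or.inr (Or.inl rfl)))).trans (β.apply_left _ _)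
      map_one_left := fun q => (hB _ _ (Or.inr (Or.inr (Or.inr rfl)))).trans (β.apply_right _ _) }
  have key : ∀ (u t s : I) (x : X), A'.trans B' (s, (u, (t, x))) =
      if (s : ℝ) ≤ 1 / 2 then A (u, (t, (pr (2 * s), x))) else B (u, (t, (pr (2 * s - 1), x))) :=
    fun _ _ _ _ => rfl
  refine ⟨⟨⟨⟨fun q => A'.trans B' (q.2.2.1, (q.1, (q.2.1, q.2.2.2))),
    (A'.trans B').continuous.comp (by fun_prop)⟩, ?_, ?_⟩, ?_⟩⟩
  · rintro ⟨t, s, x⟩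
    change A'.trans B' (s, (0, (t, x))) = α.hcomp β (t, (s, x))
    rw [key, hcomp_apply, A0, B0]
  · rintro ⟨t, s, x⟩
    change A'.trans B' (s, (1, (t, x))) = α'.hcomp β' (t, (s, x))
    rw [key, hcomp_apply, A1, B1]
  · rintro u ⟨t, s, x⟩ (ht | ht | hs | hs)
    · obtain rfl : t = 0 := ht
      change A'.trans B' (s, (u, (0, x))) = α.hcomp β (0, (s, x))
      rw [key, hcomp_apply, hA _ _ (Or.inl rfl), hB _ _ (Or.inl rfl)]
    · obtain rfl : t = 1 := ht
      change A'.trans B' (s, (u, (1, x))) = α.hcomp β (1, (s, x))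
      rw [key, hcomp_apply, hA _ _ (Or.inr (Or.inl rfl)), hB _ _ (Or.inr (Or.inl rfl))]
    · obtain rfl : s = 0 := hs
      change A'.trans B' (0, (u, (t, x))) = α.hcomp β (t, (0, x))
      rw [(A'.trans B').apply_zero, apply_left]; rfl
    · obtain rfl : s = 1 := hs
      change A'.trans B' (1, (u, (t, x))) = α.hcomp β (t, (1, x))
      rw [(A'.trans B').apply_one, apply_right]; rfl

/-! ### Reparametrization -/

/-- The straight path from `a` to `b` in the unit interval. -/
def segment (t a b : I) : I := pr ((1 - t) * a + t * b)

theorem coe_segment (t a b : I) : (segment t a b : ℝ) = (1 - t) * a + t * b := by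
  have ht := t.2
  have ha := a.2
  have hb := b.2
  rw [Set.mem_Icc] at ht ha hb
  have h0 : (0 : ℝ) ≤ (1 - t) * a + t * b := by nlinarith [mul_nonneg ht.1 hb.1]
  have h1 : (1 - t) * a + t * b ≤ (1 : ℝ) := by nlinarith
  simp [segment, Set.coe_projIcc, h0, h1]

@[simp] theorem segment_zero (a b : I) : segment 0 a b = a := Subtype.ext (by simp [coe_segment])
@[simp] theorem segment_one (a b : I) : segment 1 a b = b := Subtype.ext (by simp [coe_segment])
@[simp] theorem segment_self (t a : I) : segment t a a = a :=
  Subtype.ext (by rw [coe_segment]; ring)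

@[fun_prop]
theorem continuous_segment {Z : Type*} [TopologicalSpace Z] {t a b : Z → I} (ht : Continuous t)
    (ha : Continuous a) (hb : Continuous b) : Continuous fun z => segment (t z) (a z) (b z) := by
  unfold segment pr
  exact continuous_projIcc.comp (by fun_prop)

/-- Two homotopies obtained from the same map by reparametrizations of the square that agree where
necessary are equivalent. -/
theorem equivalent_of_reparam {H' J' : f.Homotopy g} (α β : TwoHomotopy H J)
    (M : TwoHomotopy H' J') (φ ψ : C(I × I, I × I))
    (hα : ∀ t s x, α (t, (s, x)) = M ((φ (t, s)).1, ((φ (t, s)).2, x)))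
    (hβ : ∀ t s x, β (t, (s, x)) = M ((ψ (t, s)).1, ((ψ (t, s)).2, x)))
    (h0 : ∀ s, φ (0, s) = ψ (0, s)) (h1 : ∀ s, φ (1, s) = ψ (1, s))
    (φ0 : ∀ t, (φ (t, 0)).2 = 0) (φ1 : ∀ t, (φ (t, 1)).2 = 1)
    (ψ0 : ∀ t, (ψ (t, 0)).2 = 0) (ψ1 : ∀ t, (ψ (t, 1)).2 = 1) : Equivalent α β := by
  refine ⟨⟨⟨⟨fun q => M (segment q.1 (φ (q.2.1, q.2.2.1)).1 (ψ (q.2.1, q.2.2.1)).1,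
    (segment q.1 (φ (q.2.1, q.2.2.1)).2 (ψ (q.2.1, q.2.2.1)).2, q.2.2.2)),
    M.continuous.comp (by fun_prop)⟩, ?_, ?_⟩, ?_⟩⟩
  · rintro ⟨t, s, x⟩
    refine Eq.trans ?_ (hα t s x).symm
    simp
  · rintro ⟨t, s, x⟩
    refine Eq.trans ?_ (hβ t s x).symm
    simp
  · rintro u ⟨t, s, x⟩ (ht | ht | hs | hs)
    · obtain rfl : t = 0 := ht
      refine Eq.trans ?_ (hα 0 s x).symm
      simp [← h0]
    · obtain rfl : t = 1 := ht
      refine Eq.trans ?_ (hα 1 s x).symm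
      simp [← h1]
    · obtain rfl : s = 0 := hs
      refine Eq.trans ?_ (α.apply_left t x).symm
      simp [φ0, ψ0]
    · obtain rfl : s = 1 := hs
      refine Eq.trans ?_ (α.apply_right t x).symm
      simp [φ1, ψ1]

/-- If `H` and `J` are the reparametrizations of `M` by `r` and `q`, then the straight path from
`r` to `q` gives a homotopy from `H` to `J`. -/
def reparam (M : f.Homotopy g) (r q : C(I, I)) (r0 : r 0 = 0) (r1 : r 1 = 1) (q0 : q 0 = 0)
    (q1 : q 1 = 1) (hH : ∀ s x, H (s, x) = M (r s, x)) (hJ : ∀ s x, J (s, x) = M (q s, x)) :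
    TwoHomotopy H J where
  toFun p := M (segment p.1 (r p.2.1) (q p.2.1), p.2.2)
  continuous_toFun := M.continuous.comp (by fun_prop)
  map_zero_left p := by simpa using (hH p.1 p.2).symm
  map_one_left p := by simpa using (hJ p.1 p.2).symm
  left t x := by simp [r0, q0]
  right t x := by simp [r1, q1]

/-- `α` is obtained from `M` by a reparametrization that starts with `r` and ends with `q`. -/
def IsReparam (α : TwoHomotopy H J) (M : f.Homotopy g) (r q : I → I) : Prop :=
  ∃ φ : C(I × I, I), (∀ t, φ (t, 0) = 0) ∧ (∀ t, φ (t, 1) = 1) ∧ (∀ s, φ (0, s) = r s) ∧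
    (∀ s, φ (1, s) = q s) ∧ ∀ t s x, α (t, (s, x)) = M (φ (t, s), x)

theorem isReparam_reparam (M : f.Homotopy g) (r q : C(I, I)) (r0 : r 0 = 0) (r1 : r 1 = 1)
    (q0 : q 0 = 0) (q1 : q 1 = 1) (hH : ∀ s x, H (s, x) = M (r s, x))
    (hJ : ∀ s x, J (s, x) = M (q s, x)) :
    IsReparam (reparam M r q r0 r1 q0 q1 hH hJ) M r q :=
  ⟨⟨fun p => segment p.1 (r p.2) (q p.2), by fun_prop⟩, by simp [r0, q0], by simp [r1, q1],
    by simp, by simp, fun _ _ _ => rfl⟩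

theorem IsReparam.equivalent {α β : TwoHomotopy H J} {M : f.Homotopy g} {r q : I → I}
    (hα : IsReparam α M r q) (hβ : IsReparam β M r q) : Equivalent α β := by
  obtain ⟨φ, a0, a1, ar, aq, ha⟩ := hα
  obtain ⟨ψ, b0, b1, br, bq, hb⟩ := hβ
  exact equivalent_of_reparam α β (refl M) ⟨fun p => (p.1, φ p), by fun_prop⟩
    ⟨fun p => (p.1, ψ p), by fun_prop⟩ ha hb (by simp [ar, br]) (by simp [aq, bq]) a0 a1 b0 b1

theorem isReparam_refl {M : f.Homotopy g} (r : C(I, I)) (r0 : r 0 = 0) (r1 : r 1 = 1)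
    (hH : ∀ s x, H (s, x) = M (r s, x)) : IsReparam (refl H) M r r :=
  ⟨⟨fun p => r p.2, by fun_prop⟩, by simp [r0], by simp [r1], by simp, by simp,
    fun _ s x => hH s x⟩

theorem pr_coe (s : I) : pr s = s := Set.projIcc_val _ s

theorem IsReparam.vcomp {α : TwoHomotopy H J} {β : TwoHomotopy J K} {M : f.Homotopy g}
    {r q p : I → I} (hα : IsReparam α M r q) (hβ : IsReparam β M q p) :
    IsReparam (α.vcomp β) M r p := by
  obtain ⟨φ, a0, a1, ar, aq, ha⟩ := hα
  obtain ⟨ψ, b0, b1, br, bq, hb⟩ := hβ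
  let A : ContinuousMap.Homotopy (⟨fun s => φ (0, s), by fun_prop⟩ : C(I, I))
      (⟨fun s => φ (1, s), by fun_prop⟩ : C(I, I)) := ⟨φ, fun _ => rfl, fun _ => rfl⟩
  let B : ContinuousMap.Homotopy (⟨fun s => φ (1, s), by fun_prop⟩ : C(I, I))
      (⟨fun s => ψ (1, s), by fun_prop⟩ : C(I, I)) :=
    ⟨ψ, fun s => (br s).trans (aq s).symm, fun _ => rfl⟩
  have key : ∀ t s, A.trans B (t, s) =
      if (t : ℝ) ≤ 1 / 2 then φ (pr (2 * t), s) else ψ (pr (2 * t - 1), s) := fun _ _ => rfl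
  refine ⟨(A.trans B).toContinuousMap, fun t => ?_, fun t => ?_, fun s => ?_, fun s => ?_,
    fun t s x => ?_⟩
  · refine (key t 0).trans ?_
    simp [a0, b0]
  · refine (key t 1).trans ?_
    simp [a1, b1]
  · exact ((A.trans B).apply_zero s).trans (ar s)
  · exact ((A.trans B).apply_one s).trans (bq s)
  · refine Eq.trans ?_ (congrArg (fun z => M (z, x)) (key t s)).symm
    rw [vcomp_apply]
    split_ifs
    · exact ha _ _ _
    · exact hb _ _ _

/-- Juxtaposition of two reparametrizations. -/
def juxt (r q : I → I) (s : I) : I :=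
  if (s : ℝ) ≤ 1 / 2 then pr ((r (pr (2 * s)) : ℝ) / 2) else pr ((q (pr (2 * s - 1)) + 1 : ℝ) / 2)

theorem coe_pr {a : ℝ} (h0 : 0 ≤ a) (h1 : a ≤ 1) : (pr a : ℝ) = a := by
  simp [Set.coe_projIcc, h0, h1]

theorem htrans_juxt (F : f.Homotopy g) (G : g.Homotopy h) (r q : I → I) (s : I)
    (x : X) : F.trans G (juxt r q s, x) =
      if (s : ℝ) ≤ 1 / 2 then F (r (pr (2 * s)), x) else G (q (pr (2 * s - 1)), x) := by
  rw [htrans_apply, juxt]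
  split_ifs with h1 h2 h2
  · have := (r (pr (2 * s))).2
    rw [coe_pr (by linarith [this.1]) (by linarith [this.2])]
    rw [mul_div_cancel₀ _ two_ne_zero, pr_coe]
  · have := (r (pr (2 * s))).2
    rw [coe_pr (by linarith [this.1]) (by linarith [this.2])] at h2
    exact absurd (by linarith [this.2]) h2
  · have := (q (pr (2 * s - 1))).2
    rw [coe_pr (by linarith [this.1]) (by linarith [this.2])] at h2 ⊢
    have h3 : q (pr (2 * s - 1)) = 0 := Subtype.ext (by
      change _ = (0 : ℝ)
      linarith [this.1])
    rw [h3]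
    simp
  · have := (q (pr (2 * s - 1))).2
    rw [coe_pr (by linarith [this.1]) (by linarith [this.2])]
    rw [mul_div_cancel₀ _ two_ne_zero, add_sub_cancel_right, pr_coe]

theorem IsReparam.hcomp {H H' : f.Homotopy g} {J J' : g.Homotopy h} {α : TwoHomotopy H H'}
    {β : TwoHomotopy J J'} {M : f.Homotopy g} {N : g.Homotopy h} {r q r' q' : I → I}
    (hα : IsReparam α M r q) (hβ : IsReparam β N r' q') :
    IsReparam (α.hcomp β) (M.trans N) (juxt r r') (juxt q q') := by
  obtain ⟨φ, a0, a1, ar, aq, ha⟩ := hα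
  obtain ⟨ψ, b0, b1, br, bq, hb⟩ := hβ
  have hc : Continuous fun p : I × I => juxt (fun s => φ (p.1, s)) (fun s => ψ (p.1, s)) p.2 := by
    unfold juxt pr
    refine continuous_if_le (by fun_prop) continuous_const ?_ ?_ ?_
    · exact (continuous_projIcc.comp (by fun_prop)).continuousOn
    · exact (continuous_projIcc.comp (by fun_prop)).continuousOn
    · rintro ⟨t, s⟩ hs
      simp only at hs
      simp [hs, a1, b0]
  refine ⟨⟨_, hc⟩, fun t => ?_, fun t => ?_, fun s => ?_, fun s => ?_, fun t s x => ?_⟩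
  · simp [juxt, a0]
  · norm_num [juxt, b1]
  · simp [juxt, ar, br]
  · simp [juxt, aq, bq]
  · refine Eq.trans ?_ (htrans_juxt M N _ _ s x).symm
    rw [hcomp_apply, ha, hb]

theorem IsReparam.of_eq {α : TwoHomotopy H J} {M : f.Homotopy g} {r q r' q' : I → I}
    (hα : IsReparam α M r q) (hr : r = r') (hq : q = q') : IsReparam α M r' q' := hr ▸ hq ▸ hα

theorem IsReparam.base {α : TwoHomotopy H J} {M N : f.Homotopy g} {r q : I → I}
    (hα : IsReparam α N r q) (p : C(I, I)) (p0 : p 0 = 0) (p1 : p 1 = 1)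
    (hN : ∀ s x, N (s, x) = M (p s, x)) : IsReparam α M (p ∘ r) (p ∘ q) := by
  obtain ⟨φ, a0, a1, ar, aq, ha⟩ := hα
  exact ⟨p.comp φ, by simp [a0, p0], by simp [a1, p1], by simp [ar], by simp [aq],
    fun t s x => (ha t s x).trans (hN _ _)⟩

/-- Naturality of reparametrizations. -/
theorem equivalent_naturality {M M' H₀ H₁ H₀' H₁' : f.Homotopy g} (μ : TwoHomotopy M M')
    {r q : C(I, I)}
    {A : TwoHomotopy H₀ H₀'} {B : TwoHomotopy H₁ H₁'} {c : TwoHomotopy H₀ H₁}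
    {c' : TwoHomotopy H₀' H₁'} (hc : IsReparam c M r q) (hc' : IsReparam c' M' r q)
    (hA : ∀ t s x, A (t, (s, x)) = μ (t, (r s, x)))
    (hB : ∀ t s x, B (t, (s, x)) = μ (t, (q s, x))) :
    Equivalent (A.vcomp c') (c.vcomp B) := by
  obtain ⟨φ, a0, a1, ar, aq, ha⟩ := hc
  obtain ⟨ψ, b0, b1, br, bq, hb⟩ := hc'
  have hp : Continuous pr := continuous_projIcc
  refine equivalent_of_reparam _ _ μ
    ⟨fun p => (pr (2 * p.1), ψ (pr (2 * p.1 - 1), p.2)), by fun_prop⟩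
    ⟨fun p => (pr (2 * p.1 - 1), φ (pr (2 * p.1), p.2)), by fun_prop⟩ ?_ ?_ ?_ ?_ ?_ ?_ ?_ ?_
  · intro t s x
    rw [vcomp_apply]
    split_ifs with h
    · have : pr (2 * t - 1) = 0 := Set.projIcc_of_le_left _ (by linarith)
      simp [this, br, hA]
    · have : pr (2 * t) = 1 := Set.projIcc_of_right_le _ (by linarith)
      simp [this, hb]
  · intro t s x
    rw [vcomp_apply]
    split_ifs with h
    · have : pr (2 * t - 1) = 0 := Set.projIcc_of_le_left _ (by linarith)
      simp [this, ha]
    · have : pr (2 * t) = 1 := Set.projIcc_of_right_le _ (by linarith)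
      simp [this, hB, aq]
  · intro s
    have h1 : pr (2 * ((0 : I) : ℝ) - 1) = 0 := Set.projIcc_of_le_left _ (by simp)
    have h2 : pr (2 * ((0 : I) : ℝ)) = 0 := Set.projIcc_of_le_left _ (by simp)
    simp only [ContinuousMap.coe_mk, h1, h2, ar, br]
  · intro s
    have h1 : pr (2 * ((1 : I) : ℝ) - 1) = 1 := Set.projIcc_of_right_le _ (by norm_num)
    have h2 : pr (2 * ((1 : I) : ℝ)) = 1 := Set.projIcc_of_right_le _ (by norm_num)
    simp only [ContinuousMap.coe_mk, h1, h2, aq, bq]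
  · intro t; exact b0 _
  · intro t; exact b1 _
  · intro t; exact a0 _
  · intro t; exact a1 _

/-- The reparametrization that compares the two ways of composing three homotopies. -/
def assocMap : C(I, I) :=
  ⟨fun s => pr (max (s / 2) (max (s - 1 / 4) (2 * s - 1))), continuous_projIcc.comp (by fun_prop)⟩

/-- The reparametrization that is constant on the first half of the interval. -/
def leftMap : C(I, I) := ⟨fun s => pr (2 * s - 1), continuous_projIcc.comp (by fun_prop)⟩

/-- The reparametrization that is constant on the second half of the interval. -/
def rightMap : C(I, I) := ⟨fun s => pr (2 * s), continuous_projIcc.comp (by fun_prop)⟩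

theorem coe_assocMap (s : I) :
    (assocMap s : ℝ) = max (s / 2 : ℝ) (max (s - 1 / 4) (2 * s - 1)) := by
  have := s.2
  exact coe_pr (le_max_of_le_left (by linarith [this.1]))
    (max_le (by linarith [this.2]) (max_le (by linarith [this.2]) (by linarith [this.2])))

theorem assocMap_zero : assocMap 0 = 0 := Subtype.ext (by rw [coe_assocMap]; norm_num)
theorem assocMap_one : assocMap 1 = 1 := Subtype.ext (by rw [coe_assocMap]; norm_num)
theorem leftMap_zero : leftMap 0 = 0 := Set.projIcc_of_le_left zero_le_one (by simp)
theorem leftMap_one : leftMap 1 = 1 := Set.projIcc_of_right_le zero_le_one (by norm_num)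
theorem rightMap_zero : rightMap 0 = 0 := Set.projIcc_of_le_left zero_le_one (by simp)
theorem rightMap_one : rightMap 1 = 1 := Set.projIcc_of_right_le zero_le_one (by norm_num)

section Glue

variable {Z : Type*}

/-- Juxtaposition of two functions on the unit interval. -/
def glue (a b : I → Z) (s : I) : Z :=
  if (s : ℝ) ≤ 1 / 2 then a (pr (2 * s)) else b (pr (2 * s - 1))

theorem glue_assoc (a b c : I → Z) (s : I) :
    glue a (glue b c) s = glue (glue a b) c (assocMap s) := by
  obtain ⟨s0, s1⟩ := s.2
  have hr := coe_assocMap s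
  rcases le_or_gt (s : ℝ) (1 / 2) with h | h
  · have e : (assocMap s : ℝ) = s / 2 := by
      rw [hr, max_eq_left]; exact max_le (by linarith) (by linarith)
    have e2 : ((pr (2 * (s / 2 : ℝ)) : I) : ℝ) = s := by
      rw [coe_pr (by linarith) (by linarith)]; ring
    simp only [glue, e, h, if_true]
    rw [if_pos (by linarith), e2, if_pos h]
  · rcases le_or_gt (s : ℝ) (3 / 4) with h' | h'
    · have e : (assocMap s : ℝ) = s - 1 / 4 := by
        rw [hr, max_eq_right, max_eq_left] <;> first | linarith | skip
        exact le_max_of_le_left (by linarith)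
      have e2 : ((pr (2 * (s - 1 / 4 : ℝ)) : I) : ℝ) = 2 * s - 1 / 2 := by
        rw [coe_pr (by linarith) (by linarith)]; ring
      have e3 : ((pr (2 * s - 1 : ℝ) : I) : ℝ) = 2 * s - 1 := by
        rw [coe_pr (by linarith) (by linarith)]
      simp only [glue, e, e2, e3]
      rw [if_neg (by linarith), if_pos (by linarith), if_pos (by linarith), if_neg (by linarith)]
      congr 2; ring
    · have e : (assocMap s : ℝ) = 2 * s - 1 := by
        rw [hr, max_eq_right, max_eq_right] <;> first | linarith | skip
        exact le_max_of_le_left (by linarith)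
      have e3 : ((pr (2 * s - 1 : ℝ) : I) : ℝ) = 2 * s - 1 := by
        rw [coe_pr (by linarith) (by linarith)]
      simp only [glue, e, e3]
      rw [if_neg (by linarith), if_neg (by linarith), if_neg (by linarith)]

theorem glue_left (b : I → Z) (s : I) : glue (fun _ => b 0) b s = b (leftMap s) := by
  simp only [glue]
  split_ifs with h
  · exact congrArg b (Set.projIcc_of_le_left zero_le_one (by linarith)).symm
  · rfl

theorem glue_right (a : I → Z) (s : I) : glue a (fun _ => a 1) s = a (rightMap s) := by
  simp only [glue]
  split_ifs with h
  · rfl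
  · exact congrArg a (Set.projIcc_of_right_le zero_le_one (by linarith)).symm

end Glue

theorem htrans_assoc (F : f.Homotopy g) (G : g.Homotopy h) (H : h.Homotopy k) (s : I) (x : X) :
    F.trans (G.trans H) (s, x) = (F.trans G).trans H (assocMap s, x) :=
  glue_assoc (fun s => F (s, x)) (fun s => G (s, x)) (fun s => H (s, x)) s

theorem htrans_refl_left (F : f.Homotopy g) (s : I) (x : X) :
    (ContinuousMap.Homotopy.refl f).trans F (s, x) = F (leftMap s, x) := by
  rw [← glue_left (fun s => F (s, x)), F.apply_zero]; rfl

theorem htrans_refl_right (F : f.Homotopy g) (s : I) (x : X) :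
    F.trans (ContinuousMap.Homotopy.refl g) (s, x) = F (rightMap s, x) := by
  rw [← glue_right (fun s => F (s, x)), F.apply_one]; rfl

theorem hcomp_assoc {F F' : f.Homotopy g} {G G' : g.Homotopy h} {H H' : h.Homotopy k}
    (α : TwoHomotopy F F') (β : TwoHomotopy G G') (γ : TwoHomotopy H H') (t s : I) (x : X) :
    α.hcomp (β.hcomp γ) (t, (s, x)) = (α.hcomp β).hcomp γ (t, (assocMap s, x)) :=
  glue_assoc (fun s => α (t, (s, x))) (fun s => β (t, (s, x))) (fun s => γ (t, (s, x))) s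

theorem hcomp_refl_left {F F' : f.Homotopy g} (α : TwoHomotopy F F') (t s : I) (x : X) :
    (refl (.refl f)).hcomp α (t, (s, x)) = α (t, (leftMap s, x)) := by
  rw [← glue_left (fun s => α (t, (s, x))), α.apply_left]; rfl

theorem hcomp_refl_right {F F' : f.Homotopy g} (α : TwoHomotopy F F') (t s : I) (x : X) :
    α.hcomp (refl (.refl g)) (t, (s, x)) = α (t, (rightMap s, x)) := by
  rw [← glue_right (fun s => α (t, (s, x))), α.apply_right]; rfl

theorem hcomp_refl_refl (F : f.Homotopy g) (G : g.Homotopy h) :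
    (refl F).hcomp (refl G) = refl (F.trans G) := rfl

/-! ### Laws for vertical composition -/

theorem vcomp_assoc (α : TwoHomotopy H J) (β : TwoHomotopy J K) (γ : TwoHomotopy K L) :
    Equivalent ((α.vcomp β).vcomp γ) (α.vcomp (β.vcomp γ)) := by
  refine equivalent_of_reparam _ _ ((α.vcomp β).vcomp γ) (.id _)
    ⟨fun p => (assocMap p.1, p.2), by fun_prop⟩ (fun _ _ _ => rfl) ?_ ?_ ?_ ?_ ?_ ?_ ?_
  · exact fun t s x => glue_assoc (fun t => α (t, (s, x))) (fun t => β (t, (s, x)))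
      (fun t => γ (t, (s, x))) t
  · simp [assocMap_zero]
  · simp [assocMap_one]
  all_goals simp

theorem refl_vcomp (α : TwoHomotopy H J) : Equivalent ((refl H).vcomp α) α := by
  refine equivalent_of_reparam _ _ α ⟨fun p => (leftMap p.1, p.2), by fun_prop⟩ (.id _)
    ?_ (fun _ _ _ => rfl) ?_ ?_ ?_ ?_ ?_ ?_
  · intro t s x
    refine Eq.trans ?_ (glue_left (fun t => α (t, (s, x))) t)
    rw [α.apply_zero]; rfl
  · simp [leftMap_zero]
  · simp [leftMap_one]
  all_goals simp

theorem vcomp_refl (α : TwoHomotopy H J) : Equivalent (α.vcomp (refl J)) α := by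
  refine equivalent_of_reparam _ _ α ⟨fun p => (rightMap p.1, p.2), by fun_prop⟩ (.id _)
    ?_ (fun _ _ _ => rfl) ?_ ?_ ?_ ?_ ?_ ?_
  · intro t s x
    refine Eq.trans ?_ (glue_right (fun t => α (t, (s, x))) t)
    rw [α.apply_one]; rfl
  · simp [rightMap_zero]
  · simp [rightMap_one]
  all_goals simp

theorem interchange {H H' H'' : f.Homotopy g} {J J' J'' : g.Homotopy h} (α : TwoHomotopy H H')
    (α' : TwoHomotopy H' H'') (β : TwoHomotopy J J') (β' : TwoHomotopy J' J'') :
    (α.vcomp α').hcomp (β.vcomp β') = (α.hcomp β).vcomp (α'.hcomp β') := by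
  ext t s x
  simp only [vcomp_apply, hcomp_apply]
  split_ifs <;> rfl

/-! ### The constraints -/

/-- The associativity constraint. -/
def associator (F : f.Homotopy g) (G : g.Homotopy h) (H : h.Homotopy k) :
    TwoHomotopy ((F.trans G).trans H) (F.trans (G.trans H)) :=
  reparam ((F.trans G).trans H) (.id I) assocMap rfl rfl assocMap_zero assocMap_one
    (fun _ _ => rfl) (htrans_assoc F G H)

/-- The inverse of the associativity constraint. -/
def associatorInv (F : f.Homotopy g) (G : g.Homotopy h) (H : h.Homotopy k) :
    TwoHomotopy (F.trans (G.trans H)) ((F.trans G).trans H) :=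
  reparam ((F.trans G).trans H) assocMap (.id I) assocMap_zero assocMap_one rfl rfl
    (htrans_assoc F G H) (fun _ _ => rfl)

/-- The left unit constraint. -/
def leftUnitor (F : f.Homotopy g) : TwoHomotopy ((ContinuousMap.Homotopy.refl f).trans F) F :=
  reparam F leftMap (.id I) leftMap_zero leftMap_one rfl rfl (htrans_refl_left F) (fun _ _ => rfl)

/-- The inverse of the left unit constraint. -/
def leftUnitorInv (F : f.Homotopy g) : TwoHomotopy F ((ContinuousMap.Homotopy.refl f).trans F) :=
  reparam F (.id I) leftMap rfl rfl leftMap_zero leftMap_one (fun _ _ => rfl) (htrans_refl_left F)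

/-- The right unit constraint. -/
def rightUnitor (F : f.Homotopy g) : TwoHomotopy (F.trans (ContinuousMap.Homotopy.refl g)) F :=
  reparam F rightMap (.id I) rightMap_zero rightMap_one rfl rfl (htrans_refl_right F)
    (fun _ _ => rfl)

/-- The inverse of the right unit constraint. -/
def rightUnitorInv (F : f.Homotopy g) : TwoHomotopy F (F.trans (ContinuousMap.Homotopy.refl g)) :=
  reparam F (.id I) rightMap rfl rfl rightMap_zero rightMap_one (fun _ _ => rfl)
    (htrans_refl_right F)

theorem reparam_inv {M : f.Homotopy g} {r q : C(I, I)} (r0 : r 0 = 0) (r1 : r 1 = 1)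
    (q0 : q 0 = 0) (q1 : q 1 = 1) (hH : ∀ s x, H (s, x) = M (r s, x))
    (hJ : ∀ s x, J (s, x) = M (q s, x)) :
    Equivalent ((reparam M r q r0 r1 q0 q1 hH hJ).vcomp (reparam M q r q0 q1 r0 r1 hJ hH))
      (refl H) :=
  ((isReparam_reparam ..).vcomp (isReparam_reparam ..)).equivalent (isReparam_refl r r0 r1 hH)

theorem associator_naturality {F F' : f.Homotopy g} {G G' : g.Homotopy h} {H H' : h.Homotopy k}
    (α : TwoHomotopy F F') (β : TwoHomotopy G G') (γ : TwoHomotopy H H') :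
    Equivalent (((α.hcomp β).hcomp γ).vcomp (associator F' G' H'))
      ((associator F G H).vcomp (α.hcomp (β.hcomp γ))) :=
  equivalent_naturality ((α.hcomp β).hcomp γ) (isReparam_reparam ..) (isReparam_reparam ..)
    (fun _ _ _ => rfl) (hcomp_assoc α β γ)

theorem leftUnitor_naturality {F F' : f.Homotopy g} (α : TwoHomotopy F F') :
    Equivalent (((refl (.refl f)).hcomp α).vcomp (leftUnitor F')) ((leftUnitor F).vcomp α) :=
  equivalent_naturality α (isReparam_reparam ..) (isReparam_reparam ..)
    (hcomp_refl_left α) (fun _ _ _ => rfl)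

theorem rightUnitor_naturality {F F' : f.Homotopy g} (α : TwoHomotopy F F') :
    Equivalent ((α.hcomp (refl (.refl g))).vcomp (rightUnitor F')) ((rightUnitor F).vcomp α) :=
  equivalent_naturality α (isReparam_reparam ..) (isReparam_reparam ..)
    (hcomp_refl_right α) (fun _ _ _ => rfl)

theorem juxt_id_id : juxt id id = id := by
  funext s
  obtain ⟨s0, s1⟩ := s.2
  apply Subtype.ext
  simp only [juxt, id]
  split_ifs
  · rw [coe_pr (a := 2 * s) (by linarith) (by linarith), coe_pr (by linarith) (by linarith)]
    ring
  · rw [coe_pr (a := 2 * s - 1) (by linarith) (by linarith), coe_pr (by linarith) (by linarith)]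
    ring

theorem continuous_juxt {r q : I → I} (hr : Continuous r) (hq : Continuous q) (r1 : r 1 = 1)
    (q0 : q 0 = 0) : Continuous (juxt r q) := by
  unfold juxt pr
  refine continuous_if_le (by fun_prop) continuous_const ?_ ?_ ?_
  · refine (continuous_projIcc.comp ?_).continuousOn
    exact (continuous_subtype_val.comp
      (hr.comp (continuous_projIcc.comp (by fun_prop)))).div_const 2
  · refine (continuous_projIcc.comp ?_).continuousOn
    exact ((continuous_subtype_val.comp
      (hq.comp (continuous_projIcc.comp (by fun_prop)))).add_const 1).div_const 2
  · intro s hs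
    simp [hs, r1, q0]

theorem juxt_zero {r q : I → I} (r0 : r 0 = 0) : juxt r q 0 = 0 := by simp [juxt, r0]
theorem juxt_one {r q : I → I} (q1 : q 1 = 1) : juxt r q 1 = 1 := by norm_num [juxt, q1]

theorem coe_juxt (r q : I → I) (s : I) : (juxt r q s : ℝ) =
    if (s : ℝ) ≤ 1 / 2 then (r (pr (2 * s)) : ℝ) / 2 else (q (pr (2 * s - 1)) + 1 : ℝ) / 2 := by
  have h1 := (r (pr (2 * s))).2
  have h2 := (q (pr (2 * s - 1))).2
  rw [juxt]
  split_ifs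
  · exact coe_pr (by linarith [h1.1]) (by linarith [h1.2])
  · exact coe_pr (by linarith [h2.1]) (by linarith [h2.2])

theorem coe_juxt_le {r q : I → I} {s : I} (hs : (s : ℝ) ≤ 1 / 2) :
    (juxt r q s : ℝ) = (r (pr (2 * s)) : ℝ) / 2 := by
  rw [coe_juxt, if_pos hs]

theorem coe_juxt_ge {r q : I → I} {s : I} (hs : 1 / 2 < (s : ℝ)) :
    (juxt r q s : ℝ) = (q (pr (2 * s - 1)) + 1 : ℝ) / 2 := by
  rw [coe_juxt, if_neg (not_le.2 hs)]

theorem assocMap_of_le {s : I} (h : (s : ℝ) ≤ 1 / 2) : (assocMap s : ℝ) = s / 2 := by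
  rw [coe_assocMap, max_eq_left]
  exact max_le (by linarith) (by linarith)

theorem assocMap_of_mem {s : I} (h : 1 / 2 ≤ (s : ℝ)) (h' : (s : ℝ) ≤ 3 / 4) :
    (assocMap s : ℝ) = s - 1 / 4 := by
  rw [coe_assocMap, max_eq_right, max_eq_left] <;> first | linarith | skip
  exact le_max_of_le_left (by linarith)

theorem assocMap_of_ge {s : I} (h : 3 / 4 ≤ (s : ℝ)) : (assocMap s : ℝ) = 2 * s - 1 := by
  rw [coe_assocMap, max_eq_right, max_eq_right] <;> first | linarith | skip
  exact le_max_of_le_left (by linarith)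

theorem juxt_triangle : juxt rightMap id ∘ assocMap = juxt id leftMap := by
  funext s
  obtain ⟨s0, s1⟩ := s.2
  apply Subtype.ext
  change (juxt rightMap id (assocMap s) : ℝ) = juxt id leftMap s
  have e : ∀ a : ℝ, ((rightMap (pr a) : I) : ℝ) = pr (2 * (pr a : ℝ)) := fun _ => rfl
  have e' : ∀ a : ℝ, ((leftMap (pr a) : I) : ℝ) = pr (2 * (pr a : ℝ) - 1) := fun _ => rfl
  rcases le_or_gt (s : ℝ) (1 / 2) with h | h
  · have h1 := assocMap_of_le h
    rw [coe_juxt_le (by linarith), coe_juxt_le h, h1, e, coe_pr (a := 2 * (s / 2 : ℝ)),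
      show (2 : ℝ) * (2 * (s / 2)) = 2 * s by ring]
    · rfl
    all_goals linarith
  · rw [coe_juxt_ge h, e', coe_pr (a := 2 * s - 1) (by linarith) (by linarith)]
    rcases le_or_gt (s : ℝ) (3 / 4) with h' | h'
    · have h1 := assocMap_of_mem h.le h'
      have e1 : (pr (2 * (2 * (s - 1 / 4))) : ℝ) = 1 := by
        rw [pr, Set.projIcc_of_right_le zero_le_one (by linarith)]
      have e2 : (pr (2 * (2 * s - 1) - 1) : ℝ) = 0 := by
        rw [pr, Set.projIcc_of_le_left zero_le_one (by linarith)]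
      rw [coe_juxt_le (by linarith), h1, e, coe_pr (a := 2 * (s - 1 / 4 : ℝ)), e1, e2]
      all_goals linarith
    · have h1 := assocMap_of_ge h'.le
      rw [coe_juxt_ge (by linarith), h1]
      rfl

theorem juxt_pentagon : juxt assocMap id ∘ assocMap ∘ juxt id assocMap = assocMap ∘ assocMap := by
  funext s
  obtain ⟨s0, s1⟩ := s.2
  apply Subtype.ext
  change (juxt assocMap id (assocMap (juxt id assocMap s)) : ℝ) = assocMap (assocMap s)
  rcases le_or_gt (s : ℝ) (1 / 2) with h | h
  · have h1 : (juxt id assocMap s : ℝ) = s := by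
      rw [coe_juxt_le h, id, coe_pr (by linarith) (by linarith)]; ring
    have h2 := assocMap_of_le (s := juxt id assocMap s) (by linarith)
    have h3 := assocMap_of_le h
    have h4 : (pr (2 * (assocMap (juxt id assocMap s) : ℝ)) : ℝ) = s := by
      rw [coe_pr] <;> linarith
    have h5 := assocMap_of_le (s := pr (2 * (assocMap (juxt id assocMap s) : ℝ))) (by linarith)
    have h6 := assocMap_of_le (s := assocMap s) (by linarith)
    rw [coe_juxt_le (by linarith)]
    linarith
  · have h1 := coe_juxt_ge (r := id) (q := assocMap) h
    have h0 : (pr (2 * s - 1 : ℝ) : ℝ) = 2 * s - 1 := by rw [coe_pr] <;> linarith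
    rcases le_or_gt (s : ℝ) (3 / 4) with h' | h'
    · rw [assocMap_of_le (s := pr (2 * s - 1)) (by linarith)] at h1
      have h2 := assocMap_of_mem (s := juxt id assocMap s) (by linarith) (by linarith)
      have h3 := assocMap_of_mem h.le h'
      have h4 : (pr (2 * (assocMap (juxt id assocMap s) : ℝ)) : ℝ) = s := by
        rw [coe_pr] <;> linarith
      have h5 := assocMap_of_mem (s := pr (2 * (assocMap (juxt id assocMap s) : ℝ)))
        (by linarith) (by linarith)
      have h6 := assocMap_of_le (s := assocMap s) (by linarith)
      rw [coe_juxt_le (by linarith)]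
      linarith
    · rcases le_or_gt (s : ℝ) (7 / 8) with h'' | h''
      · rw [assocMap_of_mem (s := pr (2 * s - 1)) (by linarith) (by linarith)] at h1
        have h2 := assocMap_of_mem (s := juxt id assocMap s) (by linarith) (by linarith)
        have h3 := assocMap_of_ge h'.le
        have h4 : (pr (2 * (assocMap (juxt id assocMap s) : ℝ)) : ℝ) = 2 * s - 3 / 4 := by
          rw [coe_pr] <;> linarith
        have h5 := assocMap_of_ge (s := pr (2 * (assocMap (juxt id assocMap s) : ℝ)))
          (by linarith)
        have h6 := assocMap_of_mem (s := assocMap s) (by linarith) (by linarith)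
        rw [coe_juxt_le (by linarith)]
        linarith
      · rw [assocMap_of_ge (s := pr (2 * s - 1)) (by linarith)] at h1
        have h2 := assocMap_of_ge (s := juxt id assocMap s) (by linarith)
        have h3 := assocMap_of_ge h'.le
        have h4 : (pr (2 * (assocMap (juxt id assocMap s) : ℝ) - 1) : ℝ) = 8 * s - 7 := by
          rw [coe_pr] <;> linarith
        have h6 := assocMap_of_ge (s := assocMap s) (by linarith)
        rw [coe_juxt_ge (by linarith), id]
        linarith

theorem pentagon {l m : C(X, Y)} (F : f.Homotopy g) (G : g.Homotopy h) (H : h.Homotopy l)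
    (K : l.Homotopy m) :
    Equivalent (((associator F G H).hcomp (refl K)).vcomp
        ((associator F (G.trans H) K).vcomp ((refl F).hcomp (associator G H K))))
      ((associator (F.trans G) H K).vcomp (associator F G (H.trans K))) := by
  let p : C(I, I) := ⟨juxt assocMap id,
    continuous_juxt assocMap.continuous continuous_id assocMap_one rfl⟩
  have p0 : p 0 = 0 := juxt_zero assocMap_zero
  have p1 : p 1 = 1 := juxt_one rfl
  have hp : ∀ s x, (F.trans (G.trans H)).trans K (s, x) =
      ((F.trans G).trans H).trans K (p s, x) := by
    intro s x
    refine Eq.trans ?_ (htrans_juxt ((F.trans G).trans H) K assocMap id s x).symm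
    rw [htrans_apply]
    simp only [htrans_assoc, id]
  have hp' : ∀ s x, F.trans ((G.trans H).trans K) (s, x) =
      ((F.trans G).trans H).trans K ((p.comp assocMap) s, x) := by
    intro s x
    rw [htrans_assoc, hp]
    rfl
  have h1 : IsReparam ((associator F G H).hcomp (refl K)) (((F.trans G).trans H).trans K)
      id p := by
    refine IsReparam.of_eq (IsReparam.hcomp (isReparam_reparam ..)
      (isReparam_refl (.id I) rfl rfl fun _ _ => rfl)) juxt_id_id rfl
  have h2 : IsReparam (associator F (G.trans H) K) (((F.trans G).trans H).trans K)
      p (p ∘ assocMap) := by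
    refine IsReparam.of_eq (IsReparam.base (isReparam_reparam ..) p p0 p1 hp) rfl rfl
  have h3 : IsReparam ((refl F).hcomp (associator G H K)) (((F.trans G).trans H).trans K)
      (p ∘ assocMap) (assocMap ∘ assocMap) := by
    refine IsReparam.of_eq (IsReparam.base (N := F.trans ((G.trans H).trans K))
      (IsReparam.hcomp (M := F) (isReparam_refl (.id I) rfl rfl fun _ _ => rfl)
        (isReparam_reparam ..)) (p.comp assocMap) ?_ ?_ hp') ?_ juxt_pentagon
    · simp [assocMap_zero, p0]
    · simp [assocMap_one, p1]
    · rw [show juxt (ContinuousMap.id I) (ContinuousMap.id I) = id from juxt_id_id]; rfl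
  have h4 : IsReparam (associator (F.trans G) H K) (((F.trans G).trans H).trans K)
      id assocMap := isReparam_reparam ..
  have h5 : IsReparam (associator F G (H.trans K)) (((F.trans G).trans H).trans K)
      assocMap (assocMap ∘ assocMap) :=
    IsReparam.base (isReparam_reparam ..) assocMap assocMap_zero assocMap_one
      (htrans_assoc (F.trans G) H K)
  exact (h1.vcomp (h2.vcomp h3)).equivalent (h4.vcomp h5)

theorem triangle (F : f.Homotopy g) (G : g.Homotopy h) :
    Equivalent ((associator F (.refl g) G).vcomp ((refl F).hcomp (leftUnitor G)))
      ((rightUnitor F).hcomp (refl G)) := by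
  let p : C(I, I) := ⟨juxt rightMap id,
    continuous_juxt rightMap.continuous continuous_id rightMap_one rfl⟩
  have p0 : p 0 = 0 := juxt_zero rightMap_zero
  have p1 : p 1 = 1 := juxt_one rfl
  have hp : ∀ s x, (F.trans (.refl g)).trans G (s, x) = F.trans G (p s, x) := by
    intro s x
    refine Eq.trans ?_ (htrans_juxt F G rightMap id s x).symm
    rw [htrans_apply]
    simp only [htrans_refl_right, id]
  have h1 : IsReparam (associator F (.refl g) G) (F.trans G) p (p ∘ assocMap) :=
    IsReparam.base (isReparam_reparam ..) p p0 p1 hp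
  have h2 : IsReparam ((refl F).hcomp (leftUnitor G)) (F.trans G) (p ∘ assocMap) id :=
    IsReparam.of_eq (IsReparam.hcomp (isReparam_refl (.id I) rfl rfl fun _ _ => rfl)
      (isReparam_reparam ..)) juxt_triangle.symm juxt_id_id
  have h3 : IsReparam ((rightUnitor F).hcomp (refl G)) (F.trans G) p id :=
    IsReparam.of_eq (IsReparam.hcomp (isReparam_reparam ..)
      (isReparam_refl (.id I) rfl rfl fun _ _ => rfl)) rfl juxt_id_id
  exact (h1.vcomp h2).equivalent h3

/-! ### Composition of homotopies along a common space -/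

section Tensor

variable {Z : Type w} [TopologicalSpace Z] {f' g' : C(Y, Z)}

/-- The composite `(x, s, t) ↦ β (α (x, s, t), s, t)`. -/
def tensor {H H' : f.Homotopy g} {J J' : f'.Homotopy g'} (β : TwoHomotopy J J')
    (α : TwoHomotopy H H') : TwoHomotopy (J.comp H) (J'.comp H') where
  toFun q := β (q.1, (q.2.1, α q))
  continuous_toFun := β.continuous.comp
    (continuous_fst.prodMk (continuous_snd.fst.prodMk α.continuous))
  map_zero_left q := by simp
  map_one_left q := by simp
  left t x := by simp
  right t x := by simp

theorem tensor_apply {H H' : f.Homotopy g} {J J' : f'.Homotopy g'} (β : TwoHomotopy J J')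
    (α : TwoHomotopy H H') (t s : I) (x : X) :
    tensor β α (t, (s, x)) = β (t, (s, α (t, (s, x)))) := rfl

theorem Equivalent.tensor {H H' : f.Homotopy g} {J J' : f'.Homotopy g'}
    {β β' : TwoHomotopy J J'} {α α' : TwoHomotopy H H'} (hβ : Equivalent β β')
    (hα : Equivalent α α') : Equivalent (β.tensor α) (β'.tensor α') := by
  obtain ⟨A⟩ := hα
  obtain ⟨B⟩ := hβ
  refine ⟨⟨⟨⟨fun q => B (q.1, (q.2.1, (q.2.2.1, A q))), B.continuous.comp
    (continuous_fst.prodMk (continuous_snd.fst.prodMk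
      (continuous_snd.snd.fst.prodMk A.continuous)))⟩, ?_, ?_⟩, ?_⟩⟩
  · intro q
    exact (congrArg (fun z => B (0, (q.1, (q.2.1, z)))) (A.apply_zero q)).trans (B.apply_zero _)
  · intro q
    exact (congrArg (fun z => B (1, (q.1, (q.2.1, z)))) (A.apply_one q)).trans (B.apply_one _)
  · intro u q hq
    refine (congrArg (fun z => B (u, (q.1, (q.2.1, z)))) (A.eq_fst u hq)).trans (B.eq_fst u ?_)
    exact hq

theorem trans_comp_trans {k' : C(Y, Z)} (J₁ : f'.Homotopy g') (J₂ : g'.Homotopy k')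
    (H₁ : f.Homotopy g) (H₂ : g.Homotopy h) :
    (J₁.trans J₂).comp (H₁.trans H₂) = (J₁.comp H₁).trans (J₂.comp H₂) := by
  ext ⟨s, x⟩
  simp only [ContinuousMap.Homotopy.comp_apply, htrans_apply]
  split_ifs <;> rfl

theorem tensor_vcomp {H H' H'' : f.Homotopy g} {J J' J'' : f'.Homotopy g'}
    (β : TwoHomotopy J J') (β' : TwoHomotopy J' J'') (α : TwoHomotopy H H')
    (α' : TwoHomotopy H' H'') :
    (β.vcomp β').tensor (α.vcomp α') = (β.tensor α).vcomp (β'.tensor α') := by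
  ext t s x
  simp only [tensor_apply, vcomp_apply]
  split_ifs <;> rfl

theorem tensor_hcomp {k' : C(Y, Z)} {H₁ H₁' : f.Homotopy g} {H₂ H₂' : g.Homotopy h}
    {J₁ J₁' : f'.Homotopy g'} {J₂ J₂' : g'.Homotopy k'} (β₁ : TwoHomotopy J₁ J₁')
    (β₂ : TwoHomotopy J₂ J₂') (α₁ : TwoHomotopy H₁ H₁') (α₂ : TwoHomotopy H₂ H₂')
    (q : I × (I × X)) :
    (β₁.hcomp β₂).tensor (α₁.hcomp α₂) q = (β₁.tensor α₁).hcomp (β₂.tensor α₂) q := by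
  obtain ⟨t, s, x⟩ := q
  simp only [tensor_apply, hcomp_apply]
  split_ifs <;> rfl

theorem associator_tensor {k' l' : C(Y, Z)} (J₁ : f'.Homotopy g') (J₂ : g'.Homotopy k')
    (J₃ : k'.Homotopy l') (H₁ : f.Homotopy g) (H₂ : g.Homotopy h) (H₃ : h.Homotopy k)
    (q : I × (I × X)) :
    (associator J₁ J₂ J₃).tensor (associator H₁ H₂ H₃) q =
      associator (J₁.comp H₁) (J₂.comp H₂) (J₃.comp H₃) q := by
  obtain ⟨t, s, x⟩ := q
  change ((J₁.trans J₂).trans J₃).comp ((H₁.trans H₂).trans H₃) (segment t s (assocMap s), x) =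
    (((J₁.comp H₁).trans (J₂.comp H₂)).trans (J₃.comp H₃)) (segment t s (assocMap s), x)
  rw [trans_comp_trans, trans_comp_trans]

theorem leftUnitor_tensor (J : f'.Homotopy g') (H : f.Homotopy g) (q : I × (I × X)) :
    (leftUnitor J).tensor (leftUnitor H) q = leftUnitor (J.comp H) q := rfl

theorem rightUnitor_tensor (J : f'.Homotopy g') (H : f.Homotopy g) (q : I × (I × X)) :
    (rightUnitor J).tensor (rightUnitor H) q = rightUnitor (J.comp H) q := rfl

end Tensor

theorem refl_trans_refl (f : C(X, Y)) :
    (ContinuousMap.Homotopy.refl f).trans (.refl f) = .refl f := by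
  ext ⟨s, x⟩
  rw [htrans_apply]
  split_ifs <;> rfl

end TwoHomotopy

end Homotopies

/-! ### The hom-bicategories -/

/-- The type of continuous maps between two spaces: the 0-cells of the hom-bicategory. -/
def TopHom (X Y : TopCat.{u}) : Type u := C(X, Y)

namespace TopHom

variable {X Y Z : TopCat.{u}}

/-- A homotopy from `f` to `g`: the 1-cells of the hom-bicategory. -/
def Htpy (f g : TopHom X Y) : Type u := ContinuousMap.Homotopy (X := X) (Y := Y) f g

/-- The constant homotopy. -/
def Htpy.refl (f : TopHom X Y) : Htpy f f := ContinuousMap.Homotopy.refl (X := X) (Y := Y) f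

/-- Composition of homotopies: first `H`, then `J`. -/
def Htpy.trans {f g h : TopHom X Y} (H : Htpy f g) (J : Htpy g h) : Htpy f h :=
  ContinuousMap.Homotopy.trans (X := X) (Y := Y) H J

/-- Equivalence classes of homotopies between homotopies: the 2-cells of the hom-bicategory. -/
def Cell {f g : TopHom X Y} (H J : Htpy f g) : Type u :=
  Quotient (TwoHomotopy.setoid (X := X) (Y := Y) H J)

/-- The class of a homotopy between homotopies. -/
def Cell.mk {f g : TopHom X Y} {H J : Htpy f g} (α : TwoHomotopy (X := X) (Y := Y) H J) :
    Cell H J := Quotient.mk _ α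

theorem Cell.ind {f g : TopHom X Y} {H J : Htpy f g} {p : Cell H J → Prop}
    (h : ∀ α : TwoHomotopy (X := X) (Y := Y) H J, p (Cell.mk α)) (η : Cell H J) : p η :=
  Quotient.ind h η

theorem Cell.sound {f g : TopHom X Y} {H J : Htpy f g} {α β : TwoHomotopy (X := X) (Y := Y) H J}
    (h : TwoHomotopy.Equivalent α β) : Cell.mk α = Cell.mk β := Quotient.sound h

/-- Vertical composition of classes. -/
def Cell.vcomp {f g : TopHom X Y} {H J K : Htpy f g} : Cell H J → Cell J K → Cell H K :=
  Quotient.map₂ TwoHomotopy.vcomp fun _ _ hα _ _ hβ => TwoHomotopy.Equivalent.vcomp hα hβ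

/-- Horizontal composition of classes. -/
def Cell.hcomp {f g h : TopHom X Y} {H H' : Htpy f g} {J J' : Htpy g h} :
    Cell H H' → Cell J J' → Cell (H.trans J) (H'.trans J') :=
  Quotient.map₂ TwoHomotopy.hcomp fun _ _ hα _ _ hβ => TwoHomotopy.Equivalent.hcomp hα hβ

/-- Composition of classes along a common space. -/
def Cell.tensor {f g : TopHom X Y} {f' g' : TopHom Y Z} {H H' : Htpy f g} {J J' : Htpy f' g'} :
    Cell J J' → Cell H H' →
      Cell (f := ContinuousMap.comp f' f) (g := ContinuousMap.comp g' g)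
        (ContinuousMap.Homotopy.comp J H) (ContinuousMap.Homotopy.comp J' H') :=
  Quotient.map₂ TwoHomotopy.tensor fun _ _ hα _ _ hβ => TwoHomotopy.Equivalent.tensor hα hβ

instance : CategoryStruct (TopHom X Y) where
  Hom f g := Htpy f g
  id f := Htpy.refl f
  comp H J := H.trans J

instance homCategory (f g : TopHom X Y) : Category (f ⟶ g) where
  Hom H J := Cell (f := f) (g := g) H J
  id H := Cell.mk (TwoHomotopy.refl _)
  comp η θ := Cell.vcomp η θ
  id_comp η := by
    induction η using Cell.ind with | _ α
    exact Cell.sound (TwoHomotopy.refl_vcomp α)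
  comp_id η := by
    induction η using Cell.ind with | _ α
    exact Cell.sound (TwoHomotopy.vcomp_refl α)
  assoc η θ ζ := by
    induction η using Cell.ind with | _ α
    induction θ using Cell.ind with | _ β
    induction ζ using Cell.ind with | _ γ
    exact Cell.sound (TwoHomotopy.vcomp_assoc α β γ)

/-- Horizontal composition of 2-cells. -/
def hcomp {f g h : TopHom X Y} {H H' : f ⟶ g} {J J' : g ⟶ h} (η : H ⟶ H') (θ : J ⟶ J') :
    H ≫ J ⟶ H' ≫ J' := Cell.hcomp η θ

theorem hcomp_vcomp {f g h : TopHom X Y} {H H' H'' : f ⟶ g} {J J' J'' : g ⟶ h}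
    (η : H ⟶ H') (η' : H' ⟶ H'') (θ : J ⟶ J') (θ' : J' ⟶ J'') :
    hcomp (η ≫ η') (θ ≫ θ') = hcomp η θ ≫ hcomp η' θ' := by
  induction η using Cell.ind with | _ α
  induction η' using Cell.ind with | _ α'
  induction θ using Cell.ind with | _ β
  induction θ' using Cell.ind with | _ β'
  exact congrArg Cell.mk (TwoHomotopy.interchange α α' β β')

/-- The associativity constraint. -/
def assocIso {f g h k : TopHom X Y} (F : f ⟶ g) (G : g ⟶ h) (H : h ⟶ k) :
    (F ≫ G) ≫ H ≅ F ≫ G ≫ H where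
  hom := Cell.mk (TwoHomotopy.associator F G H)
  inv := Cell.mk (TwoHomotopy.associatorInv F G H)
  hom_inv_id := Cell.sound (TwoHomotopy.reparam_inv ..)
  inv_hom_id := Cell.sound (TwoHomotopy.reparam_inv ..)

/-- The left unit constraint. -/
def leftIso {f g : TopHom X Y} (F : f ⟶ g) : 𝟙 f ≫ F ≅ F where
  hom := Cell.mk (TwoHomotopy.leftUnitor F)
  inv := Cell.mk (TwoHomotopy.leftUnitorInv F)
  hom_inv_id := Cell.sound (TwoHomotopy.reparam_inv ..)
  inv_hom_id := Cell.sound (TwoHomotopy.reparam_inv ..)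

/-- The right unit constraint. -/
def rightIso {f g : TopHom X Y} (F : f ⟶ g) : F ≫ 𝟙 g ≅ F where
  hom := Cell.mk (TwoHomotopy.rightUnitor F)
  inv := Cell.mk (TwoHomotopy.rightUnitorInv F)
  hom_inv_id := Cell.sound (TwoHomotopy.reparam_inv ..)
  inv_hom_id := Cell.sound (TwoHomotopy.reparam_inv ..)

theorem assocIso_naturality {f g h k : TopHom X Y} {F F' : f ⟶ g} {G G' : g ⟶ h} {H H' : h ⟶ k}
    (η : F ⟶ F') (θ : G ⟶ G') (ζ : H ⟶ H') :
    hcomp (hcomp η θ) ζ ≫ (assocIso F' G' H').hom =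
      (assocIso F G H).hom ≫ hcomp η (hcomp θ ζ) := by
  induction η using Cell.ind with | _ α
  induction θ using Cell.ind with | _ β
  induction ζ using Cell.ind with | _ γ
  exact Cell.sound (TwoHomotopy.associator_naturality α β γ)

theorem leftIso_naturality {f g : TopHom X Y} {F F' : f ⟶ g} (η : F ⟶ F') :
    hcomp (𝟙 (𝟙 f)) η ≫ (leftIso F').hom =
      (leftIso F).hom ≫ η := by
  induction η using Cell.ind with | _ α
  exact Cell.sound (TwoHomotopy.leftUnitor_naturality α)

theorem rightIso_naturality {f g : TopHom X Y} {F F' : f ⟶ g} (η : F ⟶ F') :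
    hcomp η (𝟙 (𝟙 g)) ≫ (rightIso F').hom =
      (rightIso F).hom ≫ η := by
  induction η using Cell.ind with | _ α
  exact Cell.sound (TwoHomotopy.rightUnitor_naturality α)

/-- The bicategory `Top (X, Y)` of continuous maps `X → Y`, homotopies, and equivalence classes of
homotopies between homotopies. -/
instance bicategory (X Y : TopCat.{u}) : Bicategory.{u, u} (TopHom X Y) where
  homCategory := homCategory
  whiskerLeft H _ _ η := hcomp (𝟙 H) η
  whiskerRight η J := hcomp η (𝟙 J)
  associator := assocIso
  leftUnitor := leftIso
  rightUnitor := rightIso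
  whiskerLeft_id _ _ := rfl
  whiskerLeft_comp H _ _ _ η θ :=
    (congrArg (hcomp · (η ≫ θ)) (Category.comp_id (𝟙 H)).symm).trans (hcomp_vcomp ..)
  id_whiskerLeft η := ((Iso.eq_comp_inv _).2 (leftIso_naturality η)).trans (Category.assoc ..)
  comp_whiskerLeft F G _ _ η :=
    ((Iso.eq_comp_inv _).2 (assocIso_naturality (𝟙 F) (𝟙 G) η)).trans (Category.assoc ..)
  id_whiskerRight _ _ := rfl
  comp_whiskerRight η θ J :=
    (congrArg (hcomp (η ≫ θ) ·) (Category.comp_id (𝟙 J)).symm).trans (hcomp_vcomp ..)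
  whiskerRight_id η := ((Iso.eq_comp_inv _).2 (rightIso_naturality η)).trans (Category.assoc ..)
  whiskerRight_comp η G H := (Iso.eq_inv_comp _).2 (assocIso_naturality η (𝟙 G) (𝟙 H)).symm
  whisker_assoc F _ _ η H :=
    ((Iso.eq_comp_inv _).2 (assocIso_naturality (𝟙 F) η (𝟙 H))).trans (Category.assoc ..)
  whisker_exchange {_ _ _ F F' G G'} η θ := by
    refine (hcomp_vcomp (𝟙 F) η θ (𝟙 G')).symm.trans (Eq.trans ?_ (hcomp_vcomp η (𝟙 F') (𝟙 G) θ))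
    rw [Category.id_comp, Category.comp_id, Category.id_comp, Category.comp_id]
  pentagon F G H K := Cell.sound (TwoHomotopy.pentagon F G H K)
  triangle F G := Cell.sound (TwoHomotopy.triangle F G)

/-! ### Composition and units -/

theorem mk_eq_eqToHom {f g : TopHom X Y} {H H' J J' : f ⟶ g} (hH : H = H') (hJ : J' = J)
    (α : TwoHomotopy (X := X) (Y := Y) (f := f) (g := g) H J)
    (β : TwoHomotopy (X := X) (Y := Y) (f := f) (g := g) H' J')
    (h : ∀ q, α.toFun q = β.toFun q) :
    (Cell.mk α : H ⟶ J) = eqToHom hH ≫ (Cell.mk β : H' ⟶ J') ≫ eqToHom hJ := by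
  subst hH hJ
  simp only [eqToHom_refl, Category.id_comp, Category.comp_id]
  exact congrArg Cell.mk (TwoHomotopy.ext fun t s x => h (t, (s, x)))

/-- The value of `⊗` on 0-cells. -/
def tensorObj (g : TopHom Y Z) (f : TopHom X Y) : TopHom X Z := ContinuousMap.comp g f

/-- The value of `⊗` on 1-cells: `(J ⊗ H) (x, s) = J (H (x, s), s)`. -/
def tensorMap {g g' : TopHom Y Z} {f f' : TopHom X Y} (J : g ⟶ g') (H : f ⟶ f') :
    tensorObj g f ⟶ tensorObj g' f' := ContinuousMap.Homotopy.comp J H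

/-- The value of `⊗` on 2-cells. -/
def tensorMap₂ {g g' : TopHom Y Z} {f f' : TopHom X Y} {J J' : g ⟶ g'} {H H' : f ⟶ f'}
    (θ : J ⟶ J') (η : H ⟶ H') : tensorMap J H ⟶ tensorMap J' H' := Cell.tensor θ η

theorem tensorMap_comp {g g' g'' : TopHom Y Z} {f f' f'' : TopHom X Y} (J₁ : g ⟶ g')
    (J₂ : g' ⟶ g'') (H₁ : f ⟶ f') (H₂ : f' ⟶ f'') :
    tensorMap (J₁ ≫ J₂) (H₁ ≫ H₂) = tensorMap J₁ H₁ ≫ tensorMap J₂ H₂ :=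
  TwoHomotopy.trans_comp_trans _ _ _ _

theorem tensorMap₂_comp {g g' : TopHom Y Z} {f f' : TopHom X Y} {J J' J'' : g ⟶ g'}
    {H H' H'' : f ⟶ f'} (θ : J ⟶ J') (θ' : J' ⟶ J'') (η : H ⟶ H') (η' : H' ⟶ H'') :
    tensorMap₂ (θ ≫ θ') (η ≫ η') = tensorMap₂ θ η ≫ tensorMap₂ θ' η' := by
  induction θ using Cell.ind with | _ β
  induction θ' using Cell.ind with | _ β'
  induction η using Cell.ind with | _ α
  induction η' using Cell.ind with | _ α'
  exact congrArg Cell.mk (TwoHomotopy.tensor_vcomp β β' α α')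

theorem tensorMap₂_hcomp {g g' g'' : TopHom Y Z} {f f' f'' : TopHom X Y} {J₁ J₁' : g ⟶ g'}
    {J₂ J₂' : g' ⟶ g''} {H₁ H₁' : f ⟶ f'} {H₂ H₂' : f' ⟶ f''} (θ₁ : J₁ ⟶ J₁') (θ₂ : J₂ ⟶ J₂')
    (η₁ : H₁ ⟶ H₁') (η₂ : H₂ ⟶ H₂') :
    tensorMap₂ (hcomp θ₁ θ₂) (hcomp η₁ η₂) =
      eqToHom (tensorMap_comp J₁ J₂ H₁ H₂) ≫ hcomp (tensorMap₂ θ₁ η₁) (tensorMap₂ θ₂ η₂) ≫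
        eqToHom (tensorMap_comp J₁' J₂' H₁' H₂').symm := by
  induction θ₁ using Cell.ind with | _ β₁
  induction θ₂ using Cell.ind with | _ β₂
  induction η₁ using Cell.ind with | _ α₁
  induction η₂ using Cell.ind with | _ α₂
  exact mk_eq_eqToHom _ _ _ _ (TwoHomotopy.tensor_hcomp β₁ β₂ α₁ α₂)

theorem tensorMap₂_associator {g₁ g₂ g₃ g₄ : TopHom Y Z} {f₁ f₂ f₃ f₄ : TopHom X Y} (J₁ : g₁ ⟶ g₂)
    (J₂ : g₂ ⟶ g₃) (J₃ : g₃ ⟶ g₄) (H₁ : f₁ ⟶ f₂) (H₂ : f₂ ⟶ f₃) (H₃ : f₃ ⟶ f₄) :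
    tensorMap₂ (α_ J₁ J₂ J₃).hom (α_ H₁ H₂ H₃).hom =
      eqToHom (by rw [tensorMap_comp, tensorMap_comp]) ≫
        (α_ (tensorMap J₁ H₁) (tensorMap J₂ H₂) (tensorMap J₃ H₃)).hom ≫
          eqToHom (by rw [tensorMap_comp, tensorMap_comp]) :=
  mk_eq_eqToHom _ _ _ _ (TwoHomotopy.associator_tensor J₁ J₂ J₃ H₁ H₂ H₃)

theorem tensorMap₂_leftUnitor {g g' : TopHom Y Z} {f f' : TopHom X Y} (J : g ⟶ g') (H : f ⟶ f') :
    tensorMap₂ (λ_ J).hom (λ_ H).hom =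
      eqToHom (tensorMap_comp (𝟙 g) J (𝟙 f) H) ≫ (λ_ (tensorMap J H)).hom := by
  refine (mk_eq_eqToHom (tensorMap_comp (𝟙 g) J (𝟙 f) H) rfl _ _
    (TwoHomotopy.leftUnitor_tensor J H)).trans ?_
  exact congrArg (_ ≫ ·) (Category.comp_id _)

theorem tensorMap₂_rightUnitor {g g' : TopHom Y Z} {f f' : TopHom X Y} (J : g ⟶ g')
    (H : f ⟶ f') :
    tensorMap₂ (ρ_ J).hom (ρ_ H).hom =
      eqToHom (tensorMap_comp J (𝟙 g') H (𝟙 f')) ≫ (ρ_ (tensorMap J H)).hom := by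
  refine (mk_eq_eqToHom (tensorMap_comp J (𝟙 g') H (𝟙 f')) rfl _ _
    (TwoHomotopy.rightUnitor_tensor J H)).trans ?_
  exact congrArg (_ ≫ ·) (Category.comp_id _)

/-- The strict functor `⊗ : Top (Y, Z) × Top (X, Y) ⥤ Top (X, Z)` given by composition of maps. -/
def tensor (X Y Z : TopCat.{u}) : StrictPseudofunctor (TopHom Y Z × TopHom X Y) (TopHom X Z) :=
  .mk'
  { obj p := tensorObj p.1 p.2
    map p := tensorMap p.1 p.2
    map₂ η := tensorMap₂ η.1 η.2
    map₂_id _ := rfl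
    map₂_comp _ _ := tensorMap₂_comp ..
    map_id _ := rfl
    map_comp _ _ := tensorMap_comp _ _ _ _
    map₂_whisker_left F _ _ η := tensorMap₂_hcomp (𝟙 F.1) η.1 (𝟙 F.2) η.2
    map₂_whisker_right η F := tensorMap₂_hcomp η.1 (𝟙 F.1) η.2 (𝟙 F.2)
    map₂_left_unitor F := tensorMap₂_leftUnitor F.1 F.2
    map₂_right_unitor F := tensorMap₂_rightUnitor F.1 F.2
    map₂_associator F G H := tensorMap₂_associator F.1 G.1 H.1 F.2 G.2 H.2 }

theorem id_comp_id (f : TopHom X Y) : 𝟙 f = 𝟙 f ≫ 𝟙 f :=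
  (TwoHomotopy.refl_trans_refl (X := X) (Y := Y) f).symm

theorem leftUnitor_id (f : TopHom X Y) : (λ_ (𝟙 f)).hom = eqToHom (id_comp_id f).symm := by
  refine (mk_eq_eqToHom (id_comp_id f).symm rfl _
    (TwoHomotopy.refl (X := X) (Y := Y) (f := f) (g := f) (𝟙 f : f ⟶ f)) fun _ => rfl).trans ?_
  exact (congrArg (_ ≫ ·) (Category.id_comp _)).trans (Category.comp_id _)

theorem rightUnitor_id (f : TopHom X Y) : (ρ_ (𝟙 f)).hom = eqToHom (id_comp_id f).symm := by
  rw [← unitors_equal, leftUnitor_id]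

theorem associator_id (f : TopHom X Y) :
    (α_ (𝟙 f) (𝟙 f) (𝟙 f)).hom = eqToHom (by rw [← id_comp_id f, ← id_comp_id f]) := by
  refine (mk_eq_eqToHom (by rw [← id_comp_id f, ← id_comp_id f]) (id_comp_id f |>.trans
    (congrArg (𝟙 f ≫ ·) (id_comp_id f))) _
    (TwoHomotopy.refl (X := X) (Y := Y) (f := f) (g := f) (𝟙 f : f ⟶ f)) ?_).trans ?_
  · rintro ⟨t, s, x⟩
    exact ContinuousMap.Homotopy.congr_fun (X := X) (Y := Y) ((congrArg
      (fun K => ContinuousMap.Homotopy.trans (X := X) (Y := Y) K (.refl f))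
      (TwoHomotopy.refl_trans_refl (X := X) (Y := Y) f)).trans
        (TwoHomotopy.refl_trans_refl (X := X) (Y := Y) f)) (_, x)
  · exact (congrArg (_ ≫ ·) (Category.id_comp _)).trans (eqToHom_trans _ _)

/-- The identity map. -/
def one (X : TopCat.{u}) : TopHom X X := ContinuousMap.id X

/-- The strict functor from the terminal bicategory to `Top (X, X)` that takes the value `1_X`. -/
def unit (X : TopCat.{u}) :
    StrictPseudofunctor (Terminal) (TopHom X X) :=
  .mk'
  { obj _ := one X
    map _ := 𝟙 (one X)
    map₂ _ := 𝟙 (𝟙 (one X))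
    map_id _ := rfl
    map_comp _ _ := id_comp_id _
    map₂_whisker_left _ _ _ _ := by simp
    map₂_whisker_right _ _ := by simp
    map₂_left_unitor _ := by rw [leftUnitor_id]; simp
    map₂_right_unitor _ := by rw [rightUnitor_id]; simp
    map₂_associator _ _ _ := by simp [associator_id] }

end TopHom

end TopTricat

end

/-! Concatenation of homotopies is associative and unital only up to reparametrization, but `⊗`
composes pointwise in the parameters. On representatives, both bracketings of three 2-cells give
`(x, s, t) ↦ γ (β (α (x, s, t), s, t), s, t)`, and composing with the constant homotopy at an
identity map changes nothing. All functors involved are strict, and a strict functor is determined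
by its values on cells (`IsStrict.ext`). Hence `⊗(⊗ × 1) = ⊗(1 × ⊗)` and `⊗(I × 1) = 1 = ⊗(1 × I)`
as functors, and `a`, `l`, `r` can be the identity adjoint equivalences.

The hom-bicategories are not strict, so an identity of functors does not by itself make the
remaining data trivial: in a general bicategory `𝟙 ≫ 𝟙` differs from `𝟙`. What saves the argument is
that a constant homotopy concatenated with itself is the same constant homotopy, and that
reparametrizing it has no effect. In `Top (X, Y)` therefore `𝟙 ≫ 𝟙 = 𝟙`, and the unit and
associativity constraints at identity 1-cells are identity 2-cells.

Consequently the source and target of each component of `π`, `μ`, `λ`, `ρ`, being built from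
identity 1-cells by composition and `⊗`, are the same identity 1-cell, and the components can be
identities. They are natural because the naturality squares of `a`, `l`, `r` are the unit squares
`sqId`, a class closed under pasting (`isIdSq_sqComp`) and under `⊗` (`isIdSq_sqMap`). In the
cocycle and normalization conditions every 2-cell that occurs is the identity of an identity 1-cell.
This class is closed under all operations used, and it has at most one member with a given source
and target, so the two sides agree (`IsIdCell₂.eq`).

Many of these equalities of 0-cells and 1-cells are not available by unfolding. The inductive
predicates `IsIdCell`, `IsIdCell₂` and `IsIdSq` absorb the transports: they say that a cell is an
identity once its boundary has been identified, and case analysis then removes the transport. -/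

namespace TopTricat

/-! ### Strict pseudofunctors

A pseudofunctor is strict if its constraints are given by equalities. -/

section Strict

variable {A : Type u₁} [Bicategory.{w₁, v₁} A] {B : Type u₂} [Bicategory.{w₂, v₂} B]
  {C : Type u₃} [Bicategory.{w₃, v₃} C] {D : Type u₄} [Bicategory.{w₄, v₄} D]

/-- An isomorphism that is given by an equality. -/
def IsEqToIso {E : Type u} [Category.{v} E] {p q : E} (i : p ≅ q) : Prop := ∃ e, i = eqToIso e

namespace IsEqToIso

variable {E : Type u₁} [Category.{v₁} E] {E' : Type u₂} [Category.{v₂} E'] {p q r : E}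

theorem refl (p : E) : IsEqToIso (Iso.refl p) := ⟨rfl, rfl⟩

theorem trans {i : p ≅ q} {j : q ≅ r} (hi : IsEqToIso i) (hj : IsEqToIso j) :
    IsEqToIso (i ≪≫ j) := by
  obtain ⟨rfl, rfl⟩ := hi
  obtain ⟨rfl, rfl⟩ := hj
  exact ⟨rfl, Iso.ext (Category.id_comp _)⟩

theorem prod {p' q' : E'} {i : p ≅ q} {j : p' ≅ q'} (hi : IsEqToIso i) (hj : IsEqToIso j) :
    IsEqToIso (Iso.prod i j) := by
  obtain ⟨rfl, rfl⟩ := hi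
  obtain ⟨rfl, rfl⟩ := hj
  exact ⟨rfl, rfl⟩

theorem map₂Iso (F : A ⥤ᵖ B) {a b : A} {p q : a ⟶ b} {i : p ≅ q} (hi : IsEqToIso i) :
    IsEqToIso (F.map₂Iso i) := by
  obtain ⟨rfl, rfl⟩ := hi
  exact ⟨rfl, Iso.ext (F.map₂_id _)⟩

/-- Two proofs of `p = q` are equal, so at most one isomorphism `p ≅ q` comes from an equality. For
this reason the constraints of a strict pseudofunctor carry no information beyond its values. -/
theorem eq {i j : p ≅ q} (hi : IsEqToIso i) (hj : IsEqToIso j) : i = j := by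
  obtain ⟨rfl, rfl⟩ := hi
  obtain ⟨_, rfl⟩ := hj
  rfl

end IsEqToIso

/-- A pseudofunctor whose constraints are given by equalities. -/
structure IsStrict (F : A ⥤ᵖ B) : Prop where
  mapId (a : A) : IsEqToIso (F.mapId a)
  mapComp {a b c : A} (p : a ⟶ b) (q : b ⟶ c) : IsEqToIso (F.mapComp p q)

theorem isStrict_toPseudofunctor (F : StrictPseudofunctor A B) : IsStrict F.toPseudofunctor where
  mapId _ := ⟨_, F.mapId_eq_eqToIso _⟩
  mapComp _ _ := ⟨_, F.mapComp_eq_eqToIso _ _⟩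

theorem isStrict_id : IsStrict (.id A) where
  mapId _ := .refl _
  mapComp _ _ := .refl _

theorem isStrict_prodAssoc : IsStrict (prodAssoc A B C) where
  mapId _ := .refl _
  mapComp _ _ := .refl _

theorem isStrict_toTerminal : IsStrict (toTerminal A) where
  mapId _ := .refl _
  -- The constraint is an inverse unitor, but the terminal bicategory has at most one 2-cell between
  -- given 1-cells.
  mapComp _ _ := ⟨rfl, Iso.ext (Subsingleton.elim _ _)⟩

theorem IsStrict.comp {F : A ⥤ᵖ B} {G : B ⥤ᵖ C} (hF : IsStrict F) (hG : IsStrict G) :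
    IsStrict (F.comp G) where
  mapId _ := ((hF.mapId _).map₂Iso G).trans (hG.mapId _)
  mapComp _ _ := ((hF.mapComp _ _).map₂Iso G).trans (hG.mapComp _ _)

theorem IsStrict.prodMap {F : A ⥤ᵖ B} {G : C ⥤ᵖ D} (hF : IsStrict F) (hG : IsStrict G) :
    IsStrict (prodMap F G) where
  mapId _ := (hF.mapId _).prod (hG.mapId _)
  mapComp _ _ := (hF.mapComp _ _).prod (hG.mapComp _ _)

theorem IsStrict.pair {F : A ⥤ᵖ B} {G : A ⥤ᵖ C} (hF : IsStrict F) (hG : IsStrict G) :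
    IsStrict (pair F G) where
  mapId _ := (hF.mapId _).prod (hG.mapId _)
  mapComp _ _ := (hF.mapComp _ _).prod (hG.mapComp _ _)

/-- Strict pseudofunctors are equal if they have the same values. -/
theorem IsStrict.ext {F G : A ⥤ᵖ B} (hF : IsStrict F) (hG : IsStrict G)
    (h : F.toPrelaxFunctor = G.toPrelaxFunctor) : F = G := by
  obtain ⟨P, i, c, _, _, _, _, _⟩ := F
  obtain ⟨_, j, d, _, _, _, _, _⟩ := G
  obtain rfl : P = _ := h
  -- Once the values agree, the constraints of both functors are parallel isomorphisms given by
  -- equalities.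
  obtain rfl : i = j := funext fun a => (hF.mapId a).eq (hG.mapId a)
  obtain rfl : @c = @d := by
    funext _ _ _ p q
    exact (hF.mapComp p q).eq (hG.mapComp p q)
  rfl

/-- The functors to be compared agree definitionally on 0-cells and 1-cells, which is why one `P`
serves both sides. Only 2-cells need an argument: these are equivalence classes, so a representative
must be chosen first. -/
theorem prelaxFunctor_ext {P : Prefunctor A B}
    {m n : ∀ {a b : A} {p q : a ⟶ b}, (p ⟶ q) → (P.map p ⟶ P.map q)} {h₁ h₂ h₁' h₂'}
    (h : ∀ {a b : A} {p q : a ⟶ b} (η : p ⟶ q), m η = n η) :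
    PrelaxFunctor.mk (B := A) (C := B) ⟨P, @m⟩ h₁ h₂ = .mk ⟨P, @n⟩ h₁' h₂' := by
  obtain rfl : @m = @n := by
    funext _ _ _ _ η
    exact h η
  rfl

end Strict

/-! ### Strict associativity and unitality of `⊗` -/

namespace TopHom

theorem tensor_assoc (W X Y Z : TopCat.{u}) :
    (prodMap (tensor X Y Z).toPseudofunctor (.id (TopHom W X))).comp
        (tensor W X Z).toPseudofunctor =
      (prodAssoc (TopHom Y Z) (TopHom X Y) (TopHom W X)).comp
        ((prodMap (.id (TopHom Y Z)) (tensor W X Y).toPseudofunctor).comp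
          (tensor W Y Z).toPseudofunctor) := by
  refine IsStrict.ext
    (((isStrict_toPseudofunctor _).prodMap isStrict_id).comp (isStrict_toPseudofunctor _))
    (isStrict_prodAssoc.comp
      ((isStrict_id.prodMap (isStrict_toPseudofunctor _)).comp (isStrict_toPseudofunctor _))) ?_
  refine prelaxFunctor_ext fun {a b p q} η => ?_
  obtain ⟨⟨η₁, η₂⟩, η₃⟩ := η
  -- Operations on classes compute only on representatives. There both bracketings are `(x, s, t) ↦
  -- α₁ (α₂ (α₃ (x, s, t), s, t), s, t)`.
  induction η₁ using Cell.ind with | _ α₁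
  induction η₂ using Cell.ind with | _ α₂
  induction η₃ using Cell.ind with | _ α₃
  rfl

/-- The unit contributes the constant homotopy at the identity map, and inserting the value of `α`
into it returns that value. -/
theorem unit_tensor (X Y : TopCat.{u}) :
    (pair ((toTerminal (TopHom X Y)).comp (unit Y).toPseudofunctor) (.id (TopHom X Y))).comp
      (tensor X Y Y).toPseudofunctor = .id (TopHom X Y) := by
  refine IsStrict.ext
    (((isStrict_toTerminal.comp (isStrict_toPseudofunctor _)).pair isStrict_id).comp
      (isStrict_toPseudofunctor _)) isStrict_id ?_
  refine prelaxFunctor_ext fun {a b p q} η => ?_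
  induction η using Cell.ind with | _ α
  rfl

theorem tensor_unit (X Y : TopCat.{u}) :
    (pair (.id (TopHom X Y)) ((toTerminal (TopHom X Y)).comp (unit X).toPseudofunctor)).comp
      (tensor X X Y).toPseudofunctor = .id (TopHom X Y) := by
  refine IsStrict.ext
    ((isStrict_id.pair (isStrict_toTerminal.comp (isStrict_toPseudofunctor _))).comp
      (isStrict_toPseudofunctor _)) isStrict_id ?_
  refine prelaxFunctor_ext fun {a b p q} η => ?_
  induction η using Cell.ind with | _ α
  rfl

end TopHom

end TopTricat

namespace TopTricat

/-! ### Identities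

Identity 1-cells, identity 2-cells on them, and naturality squares of identity transformations,
up to equality of 0-cells and 1-cells. -/

section Identities

variable {A : Type u₁} [Bicategory.{w₁, v₁} A] {B : Type u₂} [Bicategory.{w₂, v₂} B]
  {C : Type u₃} [Bicategory.{w₃, v₃} C]

/-- A 1-cell that is an identity up to equality of its source and target. -/
inductive IsIdCell : ∀ {x y : B}, (x ⟶ y) → Prop
  | id (x : B) : IsIdCell (𝟙 x)

/-- A 2-cell that is the identity of an identity 1-cell, up to equality. -/
inductive IsIdCell₂ : ∀ {x y : B} {p q : x ⟶ y}, (p ⟶ q) → Prop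
  | id (x : B) : IsIdCell₂ (𝟙 (𝟙 x))

/-- A square that is the naturality square of an identity transformation, up to equality. -/
inductive IsIdSq : ∀ {x y x' y' : B} {p : x ⟶ y} {p' : x' ⟶ y'} {η : x ⟶ x'} {η' : y ⟶ y'},
    (p ≫ η' ≅ η ≫ p') → Prop
  | id {x y : B} (p : x ⟶ y) : IsIdSq (sqId p)

/-- The first case analysis identifies `y` with `x`; the second then leaves no freedom, since `x =
x` has only one proof. This makes the source and target of each modification component equal. -/
theorem IsIdCell.eq {x y : B} {p q : x ⟶ y} (hp : IsIdCell p) (hq : IsIdCell q) : p = q := by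
  cases hp
  cases hq
  rfl

theorem IsIdCell.id₂ {x y : B} {p : x ⟶ y} (hp : IsIdCell p) : IsIdCell₂ (𝟙 p) := by
  cases hp
  exact .id _

theorem IsIdCell.eqToHom {x y : B} {p q : x ⟶ y} (hp : IsIdCell p) (e : p = q) :
    IsIdCell₂ (eqToHom e) := by
  subst e
  exact hp.id₂

theorem IsIdCell.eqToIso {x y : B} {p q : x ⟶ y} (hp : IsIdCell p) (hq : IsIdCell q) :
    IsIdCell₂ (eqToIso (hp.eq hq)).hom :=
  hp.eqToHom (hp.eq hq)

/-- The uniqueness that decides the cocycle and normalization conditions: no pasting has to be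
computed, only recognized as an identity. -/
theorem IsIdCell₂.eq {x y : B} {p q : x ⟶ y} {η θ : p ⟶ q} (hη : IsIdCell₂ η)
    (hθ : IsIdCell₂ θ) : η = θ := by
  cases hη
  cases hθ
  rfl

theorem IsIdCell₂.comp {x y : B} {p q r : x ⟶ y} {η : p ⟶ q} {θ : q ⟶ r} (hη : IsIdCell₂ η)
    (hθ : IsIdCell₂ θ) : IsIdCell₂ (η ≫ θ) := by
  cases hη
  cases hθ
  rw [Category.comp_id]
  exact .id _

theorem IsIdCell₂.inv {x y : B} {p q : x ⟶ y} {i : p ≅ q} (h : IsIdCell₂ i.hom) :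
    IsIdCell₂ i.inv := by
  -- Case analysis on `h` needs the 2-cell to be a variable, hence the isomorphism is taken apart.
  obtain ⟨i, j, h₁, h₂⟩ := i
  dsimp only at h ⊢
  cases h
  obtain rfl : j = 𝟙 _ := (Category.id_comp _).symm.trans h₁
  exact .id _

theorem isIdCell₂_map₂ (F : A ⥤ᵖ B) (hF : ∀ x, F.map (𝟙 x) = 𝟙 (F.obj x)) {x y : A}
    {p q : x ⟶ y} {η : p ⟶ q} (hη : IsIdCell₂ η) : IsIdCell₂ (F.map₂ η) := by
  cases hη
  rw [F.map₂_id, hF]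
  exact .id _

/-- `equivalenceOfEq` is a transport along `e` and does not evaluate for concrete composite
functors. With `F` and `G` arbitrary, `e` can be eliminated, which leaves the identity equivalence.
-/
theorem isIdCell_equivalenceOfEq_hom_app {F G : A ⥤ᵖ B} (e : F = G) (x : A) :
    IsIdCell ((equivalenceOfEq e).hom.app x) := by
  subst e
  exact .id _

theorem isIdCell_equivalenceOfEq_inv_app {F G : A ⥤ᵖ B} (e : F = G) (x : A) :
    IsIdCell ((equivalenceOfEq e).inv.app x) := by
  subst e
  exact .id _

theorem isIdSq_equivalenceOfEq_hom_naturality {F G : A ⥤ᵖ B} (e : F = G) {x y : A} (p : x ⟶ y) :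
    IsIdSq ((equivalenceOfEq e).hom.naturality p) := by
  subst e
  exact .id _

theorem isIdSq_equivalenceOfEq_inv_naturality {F G : A ⥤ᵖ B} (e : F = G) {x y : A} (p : x ⟶ y) :
    IsIdSq ((equivalenceOfEq e).inv.naturality p) := by
  subst e
  exact .id _

/-- If `η` and `η'` are only propositionally identities, `S` and `sqId p` have different types. The
hypothesis `h` compares them after moving along the two equalities. -/
theorem isIdSq_of_eq {x y : B} {p : x ⟶ y} {η : x ⟶ x} {η' : y ⟶ y} (S : p ≫ η' ≅ η ≫ p)
    (e : η = 𝟙 x) (e' : η' = 𝟙 y)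
    (h : S.hom ≫ eqToHom e ▷ p = p ◁ eqToHom e' ≫ (sqId p).hom) : IsIdSq S := by
  subst e e'
  obtain rfl : S = sqId p := Iso.ext (by simpa using h)
  exact .id p

/-- A unit square consists of unitors, and the unit axioms of a pseudofunctor say how these are
carried over by `F`. -/
theorem isIdSq_map (F : A ⥤ᵖ B) (hF : IsStrict F) {x y : A} (p : x ⟶ y) :
    IsIdSq ((F.mapComp p (𝟙 y)).symm ≪≫ F.map₂Iso (sqId p) ≪≫ F.mapComp (𝟙 x) p) := by
  obtain ⟨e, he⟩ := hF.mapId x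
  obtain ⟨e', he'⟩ := hF.mapId y
  refine isIdSq_of_eq _ e e' ?_
  have h := congrArg Iso.hom he
  have h' := congrArg Iso.hom he'
  rw [eqToIso.hom] at h h'
  -- By strictness the transports are the constraints `F.mapId`. The unit axioms express their
  -- whiskerings through `F.mapComp` and unitors, and everything else cancels.
  rw [← h, ← h', Pseudofunctor.whiskerRight_mapId_hom, Pseudofunctor.whiskerLeft_mapId_hom]
  have h₀ : F.map₂ (λ_ p).inv ≫ F.map₂ (λ_ p).hom = 𝟙 _ := by
    rw [← F.map₂_comp, Iso.inv_hom_id, F.map₂_id]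
  simp only [sqId, Iso.trans_hom, Iso.symm_hom, PrelaxFunctor.map₂Iso_hom, F.map₂_comp,
    Category.assoc, Iso.hom_inv_id_assoc, Iso.inv_hom_id_assoc, reassoc_of% h₀]

theorem isIdSq_sqMap (F : (A × B) ⥤ᵖ C) (hF : IsStrict F) {x y x' y' : A} {p : x ⟶ y}
    {p' : x' ⟶ y'} {η : x ⟶ x'} {η' : y ⟶ y'} {z t z' t' : B} {q : z ⟶ t} {q' : z' ⟶ t'}
    {θ : z ⟶ z'} {θ' : t ⟶ t'} {S : p ≫ η' ≅ η ≫ p'} {T : q ≫ θ' ≅ θ ≫ q'} (hS : IsIdSq S)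
    (hT : IsIdSq T) : IsIdSq (sqMap F S T) := by
  cases hS
  cases hT
  -- The unitors of a product bicategory are pairs, so a pair of unit squares is the unit square of
  -- the pair.
  exact isIdSq_map F hF (x := (x, z)) (y := (y, t)) (p, q)

/-- The naturality condition of a modification whose components are identities, between
transformations that are identities up to equality. -/
theorem IsIdSq.hom_comp_whiskerRight {x y x' y' : B} {p : x ⟶ y} {p' : x' ⟶ y'} {η θ : x ⟶ x'}
    {η' θ' : y ⟶ y'} {S : p ≫ η' ≅ η ≫ p'} {T : p ≫ θ' ≅ θ ≫ p'} (hS : IsIdSq S) (hT : IsIdSq T)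
    {ζ : η ⟶ θ} {ζ' : η' ⟶ θ'} (hζ : IsIdCell₂ ζ) (hζ' : IsIdCell₂ ζ') :
    S.hom ≫ ζ ▷ p' = p ◁ ζ' ≫ T.hom := by
  cases hS
  cases hT
  cases hζ
  cases hζ'
  simp

/-- The two unitors agree at an identity 1-cell, so the unit square there is an identity 2-cell. The
hypothesis `h` is needed because `𝟙 ≫ 𝟙` need not be an identity 1-cell in a general bicategory. -/
theorem IsIdSq.isIdCell₂ {x y x' y' : B} {p : x ⟶ y} {p' : x' ⟶ y'} {η : x ⟶ x'} {η' : y ⟶ y'}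
    {S : p ≫ η' ≅ η ≫ p'} (hS : IsIdSq S) (hp : IsIdCell p) (h : IsIdCell (p ≫ η')) :
    IsIdCell₂ S.hom := by
  cases hS
  cases hp
  rw [show (sqId (𝟙 x)).hom = 𝟙 _ by simp [sqId]]
  exact h.id₂

end Identities

/-! ### Closure of identities under the operations of `Top (X, Y)` -/

namespace TopHom

variable {X Y : TopCat.{u}}

/-- Special to `Top (X, Y)`: concatenating a constant homotopy with itself gives the same constant
homotopy on the nose. -/
theorem isIdCell_comp {x y z : TopHom X Y} {p : x ⟶ y} {q : y ⟶ z} (hp : IsIdCell p)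
    (hq : IsIdCell q) : IsIdCell (p ≫ q) := by
  cases hp
  cases hq
  rw [← id_comp_id]
  exact .id _

theorem isIdCell₂_whiskerLeft {x y z : TopHom X Y} {p : x ⟶ y} {q q' : y ⟶ z} {η : q ⟶ q'}
    (hp : IsIdCell p) (hη : IsIdCell₂ η) : IsIdCell₂ (p ◁ η) := by
  cases hp
  cases hη
  rw [whiskerLeft_id]
  exact (isIdCell_comp (.id _) (.id _)).id₂

theorem isIdCell₂_whiskerRight {x y z : TopHom X Y} {p p' : x ⟶ y} {q : y ⟶ z} {η : p ⟶ p'}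
    (hη : IsIdCell₂ η) (hq : IsIdCell q) : IsIdCell₂ (η ▷ q) := by
  cases hq
  cases hη
  rw [id_whiskerRight]
  exact (isIdCell_comp (.id _) (.id _)).id₂

theorem isIdCell₂_leftUnitor {x y : TopHom X Y} {p : x ⟶ y} (hp : IsIdCell p) :
    IsIdCell₂ (λ_ p).hom := by
  cases hp
  rw [leftUnitor_id]
  exact (isIdCell_comp (.id _) (.id _)).eqToHom _

theorem isIdCell₂_rightUnitor {x y : TopHom X Y} {p : x ⟶ y} (hp : IsIdCell p) :
    IsIdCell₂ (ρ_ p).hom := by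
  cases hp
  rw [rightUnitor_id]
  exact (isIdCell_comp (.id _) (.id _)).eqToHom _

/-- The associator is a reparametrization, and reparametrizing a constant homotopy leaves it
constant; the unitors behave in the same way. -/
theorem isIdCell₂_associator {x y z t : TopHom X Y} {p : x ⟶ y} {q : y ⟶ z} {r : z ⟶ t}
    (hp : IsIdCell p) (hq : IsIdCell q) (hr : IsIdCell r) : IsIdCell₂ (α_ p q r).hom := by
  cases hp
  cases hq
  cases hr
  rw [associator_id]
  exact (isIdCell_comp (isIdCell_comp (.id _) (.id _)) (.id _)).eqToHom _

/-- The pasting has sides `𝟙 ≫ 𝟙`, which equal `𝟙` here. The edge `p` is an arbitrary homotopy, so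
the square itself still contains nontrivial unitors. -/
theorem isIdSq_sqComp {x y x' y' x'' y'' : TopHom X Y} {p : x ⟶ y} {p' : x' ⟶ y'}
    {p'' : x'' ⟶ y''} {η : x ⟶ x'} {η' : y ⟶ y'} {θ : x' ⟶ x''} {θ' : y' ⟶ y''}
    {S : p ≫ η' ≅ η ≫ p'} {T : p' ≫ θ' ≅ θ ≫ p''} (hS : IsIdSq S) (hT : IsIdSq T) :
    IsIdSq (sqComp S T) := by
  cases hS
  cases hT
  refine isIdSq_of_eq _ (id_comp_id _).symm (id_comp_id _).symm ?_
  -- With the transports rewritten as unitors of identity 1-cells, the claim becomes a coherence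
  -- identity valid in every bicategory.
  rw [← leftUnitor_id, ← leftUnitor_id]
  simp [sqComp, sqId]

end TopHom

end TopTricat

namespace TopTricat

/-! ### Tricategories with identity constraints -/

/-- The composition functors are strict, and the associativity and unit equivalences consist of
identities. -/
structure HasIdentityConstraints (T : TricategoryData TopCat.{u} TopHom) : Prop where
  isStrict_comp (X Y Z : TopCat.{u}) : IsStrict (T.comp X Y Z)
  asc {W X Y Z : TopCat.{u}} (h : TopHom Y Z) (g : TopHom X Y) (f : TopHom W X) :
    IsIdCell (T.asc h g f)
  lft {X Y : TopCat.{u}} (f : TopHom X Y) : IsIdCell (T.lft f)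
  rgt {X Y : TopCat.{u}} (f : TopHom X Y) : IsIdCell (T.rgt f)
  ascNat {W X Y Z : TopCat.{u}} {h h' : TopHom Y Z} {g g' : TopHom X Y} {f f' : TopHom W X}
    (r : h ⟶ h') (q : g ⟶ g') (p : f ⟶ f') : IsIdSq (T.ascNat r q p)
  lftNat {X Y : TopCat.{u}} {f f' : TopHom X Y} (p : f ⟶ f') : IsIdSq (T.lftNat p)
  rgtNat {X Y : TopCat.{u}} {f f' : TopHom X Y} (p : f ⟶ f') : IsIdSq (T.rgtNat p)

namespace HasIdentityConstraints

open TopTricat.TopHom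

variable {T : TricategoryData TopCat.{u} TopHom} {V W X Y Z : TopCat.{u}}

theorem ten₁ (hT : HasIdentityConstraints T) {g g' : TopHom Y Z} {f f' : TopHom X Y} {p : g ⟶ g'}
    {q : f ⟶ f'} (hp : IsIdCell p) (hq : IsIdCell q) : IsIdCell (T.ten₁ p q) := by
  cases hp
  cases hq
  obtain ⟨e, -⟩ := (hT.isStrict_comp X Y Z).mapId (g, f)
  change IsIdCell ((T.comp X Y Z).map (𝟙 (g, f)))
  rw [e]
  exact .id _

theorem whR (hT : HasIdentityConstraints T) {g g' : TopHom Y Z} {p : g ⟶ g'} (hp : IsIdCell p)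
    (f : TopHom X Y) : IsIdCell (T.whR p f) := hT.ten₁ hp (.id _)

theorem whL (hT : HasIdentityConstraints T) (g : TopHom Y Z) {f f' : TopHom X Y} {p : f ⟶ f'}
    (hp : IsIdCell p) : IsIdCell (T.whL g p) := hT.ten₁ (.id _) hp

theorem tenSq (hT : HasIdentityConstraints T) {x y x' y' : TopHom Y Z} {p : x ⟶ y} {p' : x' ⟶ y'}
    {η : x ⟶ x'} {η' : y ⟶ y'} {z t z' t' : TopHom X Y} {q : z ⟶ t} {q' : z' ⟶ t'} {θ : z ⟶ z'}
    {θ' : t ⟶ t'} {S : p ≫ η' ≅ η ≫ p'} {U : q ≫ θ' ≅ θ ≫ q'} (hS : IsIdSq S) (hU : IsIdSq U) :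
    IsIdSq (T.tenSq S U) := isIdSq_sqMap _ (hT.isStrict_comp X Y Z) hS hU

theorem ten₂ (hT : HasIdentityConstraints T) {g g' : TopHom Y Z} {f f' : TopHom X Y}
    {p p' : g ⟶ g'} {q q' : f ⟶ f'} {η : p ≅ p'} {θ : q ≅ q'} (hη : IsIdCell₂ η.hom)
    (hθ : IsIdCell₂ θ.hom) : IsIdCell₂ (T.ten₂ η θ).hom := by
  obtain ⟨η, _, _, _⟩ := η
  obtain ⟨θ, _, _, _⟩ := θ
  dsimp only at hη hθ
  cases hη
  cases hθ
  exact isIdCell₂_map₂ (T.comp X Y Z) (fun p => ((hT.isStrict_comp X Y Z).mapId p).choose)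
    (.id (g, f))

theorem tenId (hT : HasIdentityConstraints T) (g : TopHom Y Z) (f : TopHom X Y) :
    IsIdCell₂ (T.tenId g f).hom := by
  obtain ⟨e, he⟩ := (hT.isStrict_comp X Y Z).mapId (g, f)
  rw [show T.tenId g f = eqToIso e from he]
  exact (hT.ten₁ (.id g) (.id f)).eqToHom e

theorem tenComp (hT : HasIdentityConstraints T) {g g' g'' : TopHom Y Z} {f f' f'' : TopHom X Y}
    {p : g ⟶ g'} {p' : g' ⟶ g''} {q : f ⟶ f'} {q' : f' ⟶ f''} (hp : IsIdCell p)
    (hp' : IsIdCell p') (hq : IsIdCell q) (hq' : IsIdCell q') :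
    IsIdCell₂ (T.tenComp p p' q q').hom := by
  obtain ⟨e, he⟩ := (hT.isStrict_comp X Y Z).mapComp (a := (g, f)) (b := (g', f'))
    (c := (g'', f'')) (p, q) (p', q')
  rw [show T.tenComp p p' q q' = eqToIso e from he]
  exact (hT.ten₁ (isIdCell_comp hp hp') (isIdCell_comp hq hq')).eqToHom e

/-! #### The modifications -/

/-- This and the next six statements make both ends of every modification component identity
1-cells, hence equal; the components are the isomorphisms given by these equalities. -/
theorem π_source (hT : HasIdentityConstraints T) (k : TopHom Y Z) (h : TopHom X Y)
    (g : TopHom W X) (f : TopHom V W) :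
    IsIdCell (T.whR (T.asc k h g) f ≫ T.asc k (T.ten h g) f ≫ T.whL k (T.asc h g f)) :=
  isIdCell_comp (hT.whR (hT.asc ..) _) (isIdCell_comp (hT.asc ..) (hT.whL _ (hT.asc ..)))

theorem π_target (hT : HasIdentityConstraints T) (k : TopHom Y Z) (h : TopHom X Y)
    (g : TopHom W X) (f : TopHom V W) :
    IsIdCell (T.asc (T.ten k h) g f ≫ T.asc k h (T.ten g f)) :=
  isIdCell_comp (hT.asc ..) (hT.asc ..)

theorem μ_source (hT : HasIdentityConstraints T) (g : TopHom Y Z) (f : TopHom X Y) :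
    IsIdCell (T.whR (T.rgt g) f ≫ T.asc g (T.I₀ Y) f ≫ T.whL g (T.lft f)) :=
  isIdCell_comp (hT.whR (hT.rgt _) _) (isIdCell_comp (hT.asc ..) (hT.whL _ (hT.lft _)))

theorem lam_source (hT : HasIdentityConstraints T) (g : TopHom Y Z) (f : TopHom X Y) :
    IsIdCell (T.whR (T.lft g) f) := hT.whR (hT.lft _) _

theorem lam_target (hT : HasIdentityConstraints T) (g : TopHom Y Z) (f : TopHom X Y) :
    IsIdCell (T.asc (T.I₀ Z) g f ≫ T.lft (T.ten g f)) :=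
  isIdCell_comp (hT.asc ..) (hT.lft _)

theorem rho_source (hT : HasIdentityConstraints T) (g : TopHom Y Z) (f : TopHom X Y) :
    IsIdCell (T.whL g (T.rgt f)) := hT.whL _ (hT.rgt _)

theorem rho_target (hT : HasIdentityConstraints T) (g : TopHom Y Z) (f : TopHom X Y) :
    IsIdCell (T.rgt (T.ten g f) ≫ T.asc g f (T.I₀ X)) :=
  isIdCell_comp (hT.rgt _) (hT.asc ..)

/-- The identity modifications. -/
noncomputable def mods (hT : HasIdentityConstraints T) : TricategoryModifications TopCat.{u} TopHom T where
  π k h g f := eqToIso ((hT.π_source k h g f).eq (hT.π_target k h g f))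
  μ g f := eqToIso ((hT.μ_source g f).eq (.id _))
  lam g f := eqToIso ((hT.lam_source g f).eq (hT.lam_target g f))
  rho g f := eqToIso ((hT.rho_source g f).eq (hT.rho_target g f))
  π_naturality s r q p := by
    -- The pasted square of each side is again a unit square, so `IsIdSq.hom_comp_whiskerRight`
    -- applies; the other three families are treated alike.
    have h₁ := isIdSq_sqComp (hT.tenSq (hT.ascNat s r q) (.id p)) (isIdSq_sqComp
        (hT.ascNat s (T.ten₁ r q) p) (hT.tenSq (.id s) (hT.ascNat r q p)))
    have h₂ := isIdSq_sqComp (hT.ascNat (T.ten₁ s r) q p) (hT.ascNat s r (T.ten₁ q p))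
    exact h₁.hom_comp_whiskerRight h₂ ((hT.π_source ..).eqToIso (hT.π_target ..)) ((hT.π_source ..).eqToIso (hT.π_target ..))
  μ_naturality q p := by
    have h := isIdSq_sqComp (hT.tenSq (hT.rgtNat q) (.id p)) (isIdSq_sqComp
      (hT.ascNat q (T.I₁ _) p) (hT.tenSq (.id q) (hT.lftNat p)))
    exact h.hom_comp_whiskerRight (.id _) ((hT.μ_source ..).eqToIso (.id _))
      ((hT.μ_source ..).eqToIso (.id _))
  lam_naturality q p := by
    have h₁ := hT.tenSq (hT.lftNat q) (.id p)
    have h₂ := isIdSq_sqComp (hT.ascNat (T.I₁ _) q p) (hT.lftNat (T.ten₁ q p))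
    exact h₁.hom_comp_whiskerRight h₂ ((hT.lam_source ..).eqToIso (hT.lam_target ..))
      ((hT.lam_source ..).eqToIso (hT.lam_target ..))
  rho_naturality q p := by
    have h₁ := hT.tenSq (.id q) (hT.rgtNat p)
    have h₂ := isIdSq_sqComp (hT.rgtNat (T.ten₁ q p)) (hT.ascNat q p (T.I₁ _))
    exact h₁.hom_comp_whiskerRight h₂ ((hT.rho_source ..).eqToIso (hT.rho_target ..))
      ((hT.rho_source ..).eqToIso (hT.rho_target ..))

theorem π (hT : HasIdentityConstraints T) (k : TopHom Y Z) (h : TopHom X Y) (g : TopHom W X)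
    (f : TopHom V W) : IsIdCell₂ (hT.mods.π k h g f).hom := (hT.π_source ..).eqToIso (hT.π_target ..)

theorem μ (hT : HasIdentityConstraints T) (g : TopHom Y Z) (f : TopHom X Y) :
    IsIdCell₂ (hT.mods.μ g f).hom := (hT.μ_source ..).eqToIso (.id _)

theorem lam (hT : HasIdentityConstraints T) (g : TopHom Y Z) (f : TopHom X Y) :
    IsIdCell₂ (hT.mods.lam g f).hom := (hT.lam_source ..).eqToIso (hT.lam_target ..)

theorem rho (hT : HasIdentityConstraints T) (g : TopHom Y Z) (f : TopHom X Y) :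
    IsIdCell₂ (hT.mods.rho g f).hom := (hT.rho_source ..).eqToIso (hT.rho_target ..)

/-! #### Auxiliary 3-cells -/

/-- Splitting `𝟙 f` as `𝟙 f ≫ 𝟙 f` uses an inverse unitor at an identity 1-cell, which is trivial in
`Top (X, Y)`; the rest is a constraint of the strict functor `⊗`. -/
theorem whRComp (hT : HasIdentityConstraints T) {g g' g'' : TopHom Y Z} {p : g ⟶ g'}
    {q : g' ⟶ g''} (hp : IsIdCell p) (hq : IsIdCell q) (f : TopHom X Y) :
    IsIdCell₂ (T.whRComp p q f).hom :=
  (hT.ten₂ (isIdCell_comp hp hq).id₂ (isIdCell₂_leftUnitor (.id f)).inv).comp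
    (hT.tenComp hp hq (.id f) (.id f))

theorem whLComp (hT : HasIdentityConstraints T) (g : TopHom Y Z) {f f' f'' : TopHom X Y}
    {p : f ⟶ f'} {q : f' ⟶ f''} (hp : IsIdCell p) (hq : IsIdCell q) :
    IsIdCell₂ (T.whLComp g p q).hom :=
  (hT.ten₂ (isIdCell₂_leftUnitor (.id g)).inv (isIdCell_comp hp hq).id₂).comp
    (hT.tenComp (.id g) (.id g) hp hq)

theorem whRComp₃ (hT : HasIdentityConstraints T) {g g' g'' g₃ : TopHom Y Z} {p : g ⟶ g'}
    {q : g' ⟶ g''} {r : g'' ⟶ g₃} (hp : IsIdCell p) (hq : IsIdCell q) (hr : IsIdCell r)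
    (f : TopHom X Y) : IsIdCell₂ (T.whRComp₃ p q r f).hom :=
  (hT.whRComp hp (isIdCell_comp hq hr) f).comp
    (isIdCell₂_whiskerLeft (hT.whR hp f) (hT.whRComp hq hr f))

theorem whLComp₃ (hT : HasIdentityConstraints T) (g : TopHom Y Z) {f f' f'' f₃ : TopHom X Y}
    {p : f ⟶ f'} {q : f' ⟶ f''} {r : f'' ⟶ f₃} (hp : IsIdCell p) (hq : IsIdCell q)
    (hr : IsIdCell r) : IsIdCell₂ (T.whLComp₃ g p q r).hom :=
  (hT.whLComp g hp (isIdCell_comp hq hr)).comp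
    (isIdCell₂_whiskerLeft (hT.whL g hp) (hT.whLComp g hq hr))

theorem whR₂ (hT : HasIdentityConstraints T) {g g' : TopHom Y Z} {p p' : g ⟶ g'} {η : p ≅ p'}
    (hη : IsIdCell₂ η.hom) (f : TopHom X Y) : IsIdCell₂ (T.whR₂ η f).hom :=
  hT.ten₂ hη (.id _)

theorem whL₂ (hT : HasIdentityConstraints T) (g : TopHom Y Z) {f f' : TopHom X Y} {p p' : f ⟶ f'}
    {η : p ≅ p'} (hη : IsIdCell₂ η.hom) : IsIdCell₂ (T.whL₂ g η).hom :=
  hT.ten₂ (.id _) hη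

end HasIdentityConstraints

end TopTricat

namespace TopTricat

/-! ### The 3-cells in the axioms, and the axioms themselves -/

namespace HasIdentityConstraints

open TopTricat.TopHom

variable {T : TricategoryData TopCat.{u} TopHom} {U V W X Y Z : TopCat.{u}}

/-- The axioms use naturality of `a` only at 1-cells `p` that are components of `a`, `l` or the
inverse of `r`, hence identities. There the unit square is an identity 2-cell, and the correction by
`tenId` is one by strictness. -/
theorem ascNat₁ (hT : HasIdentityConstraints T) {h h' : TopHom Y Z} {p : h ⟶ h'} (hp : IsIdCell p)
    (g : TopHom X Y) (f : TopHom W X) : IsIdCell₂ (T.ascNat₁ p g f).hom :=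
  ((hT.ascNat p (𝟙 g) (𝟙 f)).isIdCell₂ (hT.whR (hT.whR hp g) f)
    (isIdCell_comp (hT.whR (hT.whR hp g) f) (hT.asc h' g f))).comp
      (isIdCell₂_whiskerLeft (hT.asc h g f) (hT.ten₂ hp.id₂ (hT.tenId g f)))

theorem ascNat₂ (hT : HasIdentityConstraints T) (h : TopHom Y Z) {g g' : TopHom X Y} {p : g ⟶ g'}
    (hp : IsIdCell p) (f : TopHom W X) : IsIdCell₂ (T.ascNat₂ h p f).hom :=
  (hT.ascNat (𝟙 h) p (𝟙 f)).isIdCell₂ (hT.whR (hT.whL h hp) f)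
    (isIdCell_comp (hT.whR (hT.whL h hp) f) (hT.asc h g' f))

theorem ascNat₃ (hT : HasIdentityConstraints T) (h : TopHom Y Z) (g : TopHom X Y)
    {f f' : TopHom W X} {p : f ⟶ f'} (hp : IsIdCell p) : IsIdCell₂ (T.ascNat₃ h g p).hom :=
  have hq := hT.ten₁ (hT.ten₁ (.id h) (.id g)) hp
  (isIdCell₂_whiskerRight (hT.ten₂ (hT.tenId h g).inv hp.id₂) (hT.asc h g f')).comp
    ((hT.ascNat (𝟙 h) (𝟙 g) p).isIdCell₂ hq (isIdCell_comp hq (hT.asc h g f')))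

/-- Each whiskered modification component is conjugated by cells that distribute `⊗` over
composites; all three factors are identities of identity 1-cells. -/
theorem πR (hT : HasIdentityConstraints T) (k : TopHom Y Z) (j : TopHom X Y) (h : TopHom W X)
    (g : TopHom V W) (f : TopHom U V) : IsIdCell₂ (hT.mods.πR k j h g f).hom :=
  (hT.whRComp₃ (hT.whR (hT.asc ..) _) (hT.asc ..) (hT.whL _ (hT.asc ..)) f).inv.comp
    ((hT.whR₂ (hT.π k j h g) f).comp (hT.whRComp (hT.asc ..) (hT.asc ..) f))

theorem πL (hT : HasIdentityConstraints T) (k : TopHom Y Z) (j : TopHom X Y) (h : TopHom W X)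
    (g : TopHom V W) (f : TopHom U V) : IsIdCell₂ (hT.mods.πL k j h g f).hom :=
  (hT.whLComp₃ k (hT.whR (hT.asc ..) _) (hT.asc ..) (hT.whL _ (hT.asc ..))).inv.comp
    ((hT.whL₂ k (hT.π j h g f)).comp (hT.whLComp k (hT.asc ..) (hT.asc ..)))

theorem μR (hT : HasIdentityConstraints T) (h : TopHom Y Z) (g : TopHom X Y) (f : TopHom W X) :
    IsIdCell₂ (hT.mods.μR h g f).hom :=
  (hT.whRComp₃ (hT.whR (hT.rgt _) _) (hT.asc ..) (hT.whL _ (hT.lft _)) f).inv.comp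
    ((hT.whR₂ (hT.μ h g) f).comp (hT.tenId _ f))

theorem μL (hT : HasIdentityConstraints T) (h : TopHom Y Z) (g : TopHom X Y) (f : TopHom W X) :
    IsIdCell₂ (hT.mods.μL h g f).hom :=
  (hT.whLComp₃ h (hT.whR (hT.rgt _) _) (hT.asc ..) (hT.whL _ (hT.lft _))).inv.comp
    ((hT.whL₂ h (hT.μ g f)).comp (hT.tenId h _))

theorem lamL (hT : HasIdentityConstraints T) (h : TopHom Y Z) (g : TopHom X Y) (f : TopHom W X) :
    IsIdCell₂ (hT.mods.lamL h g f).hom :=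
  (hT.whL₂ h (hT.lam g f)).comp (hT.whLComp h (hT.asc ..) (hT.lft _))

theorem rhoR (hT : HasIdentityConstraints T) (h : TopHom Y Z) (g : TopHom X Y) (f : TopHom W X) :
    IsIdCell₂ (hT.mods.rhoR h g f).hom :=
  (hT.whR₂ (hT.rho h g) f).comp (hT.whRComp (hT.rgt _) (hT.asc ..) f)

/-! #### The axioms -/

theorem cocycle (hT : HasIdentityConstraints T) (k : TopHom Y Z) (j : TopHom X Y)
    (h : TopHom W X) (g : TopHom V W) (f : TopHom U V) : hT.mods.Cocycle k j h g f := by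
  unfold TricategoryModifications.Cocycle
  -- The two pastings are parallel, so each one only has to be recognized as the identity of an
  -- identity 1-cell.
  refine IsIdCell₂.eq ?_ ?_ <;>
  -- Each `⊗≫` hides a rebracketing; unfolding it exhibits whiskered associators and their inverses.
  simp only [bicategoricalComp, BicategoricalCoherence.refl_iso,
    BicategoricalCoherence.whiskerLeft_iso, BicategoricalCoherence.whiskerRight_iso,
    BicategoricalCoherence.assoc_iso, BicategoricalCoherence.assoc'_iso, Iso.trans_hom,
    Iso.symm_hom, Iso.refl_hom, whiskerLeftIso_hom, whiskerRightIso_hom] <;>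
  -- Structural recursion over the pasting by the closure lemmas. Reducible transparency makes each
  -- rule match the visible form of a cell, without unfolding it into homotopies or into `⊗` of a
  -- pair.
  repeat' with_reducible first
    | exact .id _
    | apply isIdCell_comp
    | apply hT.asc
    | apply hT.whR
    | apply hT.whL
    | apply IsIdCell₂.comp
    | apply isIdCell₂_whiskerLeft
    | apply isIdCell₂_whiskerRight
    | apply isIdCell₂_leftUnitor
    | apply isIdCell₂_rightUnitor
    | apply isIdCell₂_associator
    | apply IsIdCell₂.inv
    | apply hT.ascNat₁
    | apply hT.ascNat₂
    | apply hT.ascNat₃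
    | apply hT.π
    | apply hT.πR
    | apply hT.πL
    | apply IsIdCell.id₂

theorem left_normalization (hT : HasIdentityConstraints T) (h : TopHom Y Z) (g : TopHom X Y)
    (f : TopHom W X) : hT.mods.LeftNormalization h g f := by
  unfold TricategoryModifications.LeftNormalization
  refine IsIdCell₂.eq ?_ ?_ <;>
  -- Unitors also occur among the coherence cells here, since `μ` ends at an identity 1-cell.
  simp only [bicategoricalComp, BicategoricalCoherence.refl_iso,
    BicategoricalCoherence.whiskerLeft_iso, BicategoricalCoherence.whiskerRight_iso,
    BicategoricalCoherence.left_iso, BicategoricalCoherence.right_iso,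
    BicategoricalCoherence.assoc_iso, BicategoricalCoherence.assoc'_iso, Iso.trans_hom,
    Iso.symm_hom, Iso.refl_hom, whiskerLeftIso_hom, whiskerRightIso_hom] <;>
  repeat' with_reducible first
    | exact .id _
    | apply isIdCell_comp
    | apply hT.asc
    | apply hT.lft
    | apply hT.rgt
    | apply hT.whR
    | apply hT.whL
    | apply IsIdCell₂.comp
    | apply isIdCell₂_whiskerLeft
    | apply isIdCell₂_whiskerRight
    | apply isIdCell₂_leftUnitor
    | apply isIdCell₂_rightUnitor
    | apply isIdCell₂_associator
    | apply IsIdCell₂.inv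
    | apply hT.ascNat₁
    | apply hT.ascNat₂
    | apply hT.π
    | apply hT.μ
    | apply hT.μR
    | apply hT.lamL
    | apply IsIdCell.id₂

theorem right_normalization (hT : HasIdentityConstraints T) (h : TopHom Y Z) (g : TopHom X Y)
    (f : TopHom W X) : hT.mods.RightNormalization h g f := by
  unfold TricategoryModifications.RightNormalization
  refine IsIdCell₂.eq ?_ ?_ <;>
  simp only [bicategoricalComp, BicategoricalCoherence.refl_iso,
    BicategoricalCoherence.whiskerLeft_iso, BicategoricalCoherence.whiskerRight_iso,
    BicategoricalCoherence.left_iso, BicategoricalCoherence.right_iso,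
    BicategoricalCoherence.assoc_iso, BicategoricalCoherence.assoc'_iso, Iso.trans_hom,
    Iso.symm_hom, Iso.refl_hom, whiskerLeftIso_hom, whiskerRightIso_hom] <;>
  repeat' with_reducible first
    | exact .id _
    | apply isIdCell_comp
    | apply hT.asc
    | apply hT.lft
    | apply hT.rgt
    | apply hT.whR
    | apply hT.whL
    | apply IsIdCell₂.comp
    | apply isIdCell₂_whiskerLeft
    | apply isIdCell₂_whiskerRight
    | apply isIdCell₂_leftUnitor
    | apply isIdCell₂_rightUnitor
    | apply isIdCell₂_associator
    | apply IsIdCell₂.inv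
    | apply hT.ascNat₂
    | apply hT.ascNat₃
    | apply hT.π
    | apply hT.μ
    | apply hT.μL
    | apply hT.rhoR
    | apply IsIdCell.id₂

end HasIdentityConstraints

end TopTricat

namespace TopTricat

/-! ### The tricategory of spaces -/

namespace TopHom

/-- The composition, the units, and the identity adjoint equivalences for associativity and units
of the tricategory of topological spaces. -/
noncomputable def tricategoryData : TricategoryData TopCat.{u} TopHom where
  comp X Y Z := (tensor X Y Z).toPseudofunctor
  unit X := (unit X).toPseudofunctor
  assoc W X Y Z := equivalenceOfEq (tensor_assoc W X Y Z)
  left X Y := equivalenceOfEq (unit_tensor X Y)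
  right X Y := equivalenceOfEq (tensor_unit X Y)

/-- The data of `a` and `l` come from the forward halves of the equivalences, those of `r` from its
adjoint inverse, which is the half occurring in `μ` and `ρ`. -/
theorem hasIdentityConstraints_tricategoryData :
    HasIdentityConstraints tricategoryData.{u} where
  isStrict_comp X Y Z := isStrict_toPseudofunctor (tensor X Y Z)
  asc _ _ _ := isIdCell_equivalenceOfEq_hom_app (tensor_assoc _ _ _ _) _
  lft _ := isIdCell_equivalenceOfEq_hom_app (unit_tensor _ _) _
  rgt _ := isIdCell_equivalenceOfEq_inv_app (tensor_unit _ _) _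
  ascNat _ _ _ := isIdSq_equivalenceOfEq_hom_naturality (tensor_assoc _ _ _ _) _
  lftNat _ := isIdSq_equivalenceOfEq_hom_naturality (unit_tensor _ _) _
  rgtNat _ := isIdSq_equivalenceOfEq_inv_naturality (tensor_unit _ _) _

/-- The tricategory of topological spaces. -/
noncomputable def tricategory : Tricategory TopCat.{u} TopHom where
  toTricategoryData := tricategoryData
  mods := hasIdentityConstraints_tricategoryData.mods
  cocycle := hasIdentityConstraints_tricategoryData.cocycle
  left_normalization := hasIdentityConstraints_tricategoryData.left_normalization
  right_normalization := hasIdentityConstraints_tricategoryData.right_normalization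

end TopHom

end TopTricat

theorem mainTheorem12 :
    ∃ T : TopTricat.Tricategory TopCat.{u} TopTricat.TopHom,
      (∀ X Y Z, T.comp X Y Z = (TopTricat.TopHom.tensor X Y Z).toPseudofunctor) ∧
      (∀ X, T.unit X = (TopTricat.TopHom.unit X).toPseudofunctor) ∧
      (∀ W X Y Z, ∃ e, T.assoc W X Y Z = TopTricat.equivalenceOfEq e) ∧
      (∀ X Y, ∃ e, T.left X Y = TopTricat.equivalenceOfEq e) ∧
      (∀ X Y, ∃ e, T.right X Y = TopTricat.equivalenceOfEq e) ∧
      (∀ {V W X Y Z : TopCat.{u}} (k : TopTricat.TopHom Y Z) (h : TopTricat.TopHom X Y)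
        (g : TopTricat.TopHom W X) (f : TopTricat.TopHom V W),
        ∃ e, T.mods.π k h g f = eqToIso e) ∧
      (∀ {X Y Z : TopCat.{u}} (g : TopTricat.TopHom Y Z) (f : TopTricat.TopHom X Y),
        (∃ e, T.mods.μ g f = eqToIso e) ∧ (∃ e, T.mods.lam g f = eqToIso e) ∧
          (∃ e, T.mods.rho g f = eqToIso e)) := by
  -- Every clause holds by construction; the equalities asked for are those from which the
  -- equivalences and modification components were built.
  exact ⟨TopTricat.TopHom.tricategory, fun _ _ _ => rfl, fun _ => rfl, fun _ _ _ _ => ⟨_, rfl⟩,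
    fun _ _ => ⟨_, rfl⟩, fun _ _ => ⟨_, rfl⟩, fun _ _ _ _ => ⟨_, rfl⟩,
    fun _ _ => ⟨⟨_, rfl⟩, ⟨_, rfl⟩, ⟨_, rfl⟩⟩⟩
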